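/- Let $p,q\ge 0$ and $n=p+q$. Let $K=GL_p\times GL_q\subset GL_n(\mathbb C)$ be the subgroup of block diagonal matrices with an upper-left $p\times p$ block and a lower-right $q\times q$ block, acting on the variety of complete flags $F_\bullet$ in $\mathbb C^n$ ($\dim F_i=i$). Let $E_p$ be the span of the first $p$ standard basis vectors of $\mathbb C^n$, $\widetilde E_q$ the span of the last $q$, and $\pi:\mathbb C^n\to E_p$ the projection along $\widetilde E_q$. A clan of signature $(p,q)$ is an involution of $\{1,\dots,n\}$ each of whose fixed points is decorated by a sign $+$ or $-$, the number of $+$ minus the number of $-$ being $p-q$; it is written as a string $c_1\cdots c_n$ of signs and of natural numbers, the two positions of each $2$-cycle carrying the same natural number and different $2$-cycles carrying different numbers. For a clan $\gamma=c_1\cdots c_n$ let $\gamma(i;\pm)$ be the number of signs $\pm$ plus the number of pairs of equal natural numbers occurring among $c_1,\dots,c_i$, and for $i<j$ let $\gamma(i;j)$ be the number of pairs $c_s=c_t\in\mathbb N$ with $s\le i<j<t$. Let $Q_\gamma$ be the set of all flags $F_\bullet$ such that $\dim(F_i\cap E_p)=\gamma(i;+)$ and $\dim(F_i\cap\widetilde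 E_q)=\gamma(i;-)$ for all $1\le i\le n$, and $\dim(\pi(F_i)+F_j)=j+\gamma(i;j)$ for all $1\le i<j\le n$. Then, for every clan $\gamma$ of signature $(p,q)$, $Q_\gamma$ is a single $K$-orbit, and its (Zariski) closure $Y_\gamma$ in the flag variety is precisely the set of all flags $F_\bullet$ satisfying 1. $\dim(F_i\cap E_p)\ge\gamma(i;+)$ for all $1\le i\le n$; 2. $\dim(F_i\cap\widetilde E_q)\ge\gamma(i;-)$ for all $1\le i\le n$; 3. $\dim(\pi(F_i)+F_j)\le j+\gamma(i;j)$ for all $1\le i<j\le n$. -/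

import Mathlib

namespace ClanOrbits

open Module

/-- A clan of signature `(p, q)`: an involution of the `p + q` positions (numbered from `0`), each of
whose fixed points is decorated by exactly one of the signs `+`, `-`, such that the number of `+` signs
minus the number of `-` signs is `p - q`. The positions interchanged by the involution are the
positions carrying equal natural numbers. -/
structure Clan (p q : ℕ) where
  /-- the underlying involution -/
  inv : Equiv.Perm (Fin (p + q))
  inv_inv : ∀ k, inv (inv k) = k
  /-- the fixed points decorated by `+` -/
  plus : Finset (Fin (p + q))
  /-- the fixed points decorated by `-` -/
  minus : Finset (Fin (p + q))
  fixed_iff : ∀ k, inv k = k ↔ k ∈ plus ∨ k ∈ minus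
  disjoint : Disjoint plus minus
  signature : (plus.card : ℤ) - (minus.card : ℤ) = (p : ℤ) - (q : ℤ)

namespace Clan

variable {p q : ℕ} (γ : Clan p q)

/-- The number of pairs of equal natural numbers occurring among the first `i` characters. A pair is
counted through its first position `s`; its second position is `γ.inv s`. -/
def pairsUpTo (i : ℕ) : ℕ :=
  (Finset.univ.filter fun s : Fin (p + q) => s < γ.inv s ∧ (γ.inv s : ℕ) < i).card

/-- `γ(i; +)`: the number of plus signs and pairs of equal natural numbers among the first `i`
characters. -/
def rankPlus (i : ℕ) : ℕ :=
  (γ.plus.filter fun k : Fin (p + q) => (k : ℕ) < i).card + γ.pairsUpTo i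

/-- `γ(i; -)`: the number of minus signs and pairs of equal natural numbers among the first `i`
characters. -/
def rankMinus (i : ℕ) : ℕ :=
  (γ.minus.filter fun k : Fin (p + q) => (k : ℕ) < i).card + γ.pairsUpTo i

/-- `γ(i; j)` for `i < j`: the number of pairs of equal natural numbers whose first member is among the
first `i` characters and whose second member is not among the first `j` characters. -/
def rankCross (i j : ℕ) : ℕ :=
  (Finset.univ.filter fun s : Fin (p + q) => (s : ℕ) < i ∧ j ≤ (γ.inv s : ℕ)).card

end Clan

/-- A complete flag `F_0 ⊂ F_1 ⊂ ⋯ ⊂ F_n` in `ℂⁿ`, with `dim F_i = i`. -/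
@[ext]
structure CompleteFlag (n : ℕ) where
  /-- the `i`-th subspace -/
  space : Fin (n + 1) → Submodule ℂ (Fin n → ℂ)
  mono : Monotone space
  finrank_space : ∀ i, finrank ℂ (space i) = (i : ℕ)

/-- `GL_n(ℂ)` acts on complete flags by `(g • F)_i = g (F_i)`. -/
noncomputable instance (n : ℕ) : MulAction (GL (Fin n) ℂ) (CompleteFlag n) where
  smul g F :=
    { space := fun i => (F.space i).map (g : Matrix (Fin n) (Fin n) ℂ).mulVecLin
      mono := fun _ _ h => Submodule.map_mono (F.mono h)
      finrank_space := fun i => by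
        have hinj : Function.Injective (g : Matrix (Fin n) (Fin n) ℂ).mulVecLin :=
          Matrix.mulVec_injective_of_isUnit g.isUnit
        rw [← F.finrank_space i]
        exact (Submodule.equivMapOfInjective _ hinj (F.space i)).finrank_eq.symm }
  one_smul F := by
    ext1
    funext i
    change (F.space i).map ((1 : GL (Fin n) ℂ) : Matrix (Fin n) (Fin n) ℂ).mulVecLin = F.space i
    simp
  mul_smul g h F := by
    ext1
    funext i
    change (F.space i).map ((g * h : GL (Fin n) ℂ) : Matrix (Fin n) (Fin n) ℂ).mulVecLin =
      ((F.space i).map (h : Matrix (Fin n) (Fin n) ℂ).mulVecLin).map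
        (g : Matrix (Fin n) (Fin n) ℂ).mulVecLin
    rw [← Submodule.map_comp, ← Matrix.mulVecLin_mul]
    rfl

/-- The standard flag: `F_i` is spanned by the first `i` standard basis vectors. -/
def standardFlag (n : ℕ) : CompleteFlag n where
  space i := Submodule.span ℂ ((fun k : Fin n => (Pi.single k 1 : Fin n → ℂ)) '' {k | (k : ℕ) < i})
  mono i j h := Submodule.span_mono (Set.image_mono fun k (hk : (k : ℕ) < i) =>
    lt_of_lt_of_le hk (show (i : ℕ) ≤ j from h))
  finrank_space i := by
    classical
    have hb : LinearIndependent ℂ (fun k : Fin n => (Pi.single k 1 : Fin n → ℂ)) := by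
      have h := (Pi.basisFun ℂ (Fin n)).linearIndependent
      have he : (fun k : Fin n => (Pi.single k 1 : Fin n → ℂ)) = Pi.basisFun ℂ (Fin n) := by
        funext k
        simp
      rwa [he]
    have h := finrank_span_eq_card (hb.comp (Subtype.val : {k : Fin n // (k : ℕ) < i} → Fin n)
      Subtype.val_injective)
    rw [Set.range_comp, Subtype.range_coe_subtype] at h
    rw [h, Fintype.card_subtype, Fin.card_filter_val_lt]
    exact min_eq_right (Nat.lt_succ_iff.mp i.2)

/-- The set of zeros in `GL_n(ℂ)` of a set of polynomials in the `n²` matrix entries. -/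
def zeroSet {n : ℕ} (S : Set (MvPolynomial (Fin n × Fin n) ℂ)) : Set (GL (Fin n) ℂ) :=
  {g | ∀ f ∈ S, MvPolynomial.eval (fun ij => (g : Matrix (Fin n) (Fin n) ℂ) ij.1 ij.2) f = 0}

/-- The Zariski topology on the algebraic group `GL_n(ℂ)`: the closed sets are the zero sets of
polynomials in the matrix entries. -/
abbrev zariskiGL (n : ℕ) : TopologicalSpace (GL (Fin n) ℂ) :=
  TopologicalSpace.ofClosed {Z | ∃ S : Set (MvPolynomial (Fin n × Fin n) ℂ), Z = zeroSet S}
    ⟨{1}, by ext g; simp [zeroSet]⟩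
    (by
      intro A hA
      refine ⟨⋃₀ {S | zeroSet S ∈ A}, ?_⟩
      ext g
      constructor
      · rintro hg f ⟨S, hS, hf⟩
        exact hg _ hS f hf
      · intro hg Z hZ
        obtain ⟨S, rfl⟩ := hA hZ
        exact fun f hf => hg f ⟨S, hZ, hf⟩)
    (by
      rintro _ ⟨S, rfl⟩ _ ⟨T, rfl⟩
      refine ⟨{h | ∃ f ∈ S, ∃ f' ∈ T, h = f * f'}, ?_⟩
      ext g
      constructor
      · rintro (hg | hg) _ ⟨f, hf, f', hf', rfl⟩
        · rw [map_mul, hg f hf, zero_mul]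
        · rw [map_mul, hg f' hf', mul_zero]
      · intro hg
        by_contra hcon
        simp only [Set.mem_union, not_or, zeroSet, Set.mem_ofPred_eq, not_forall] at hcon
        obtain ⟨⟨f, hf, h1⟩, ⟨f', hf', h2⟩⟩ := hcon
        have h3 := hg _ ⟨f, hf, f', hf', rfl⟩
        rw [map_mul] at h3
        exact (mul_ne_zero h1 h2) h3)

/-- The Zariski topology on the flag variety `GL_n / B`. The orbit map `g ↦ g • standardFlag` is
surjective and its fibres are the cosets `g B` of the group `B` of upper triangular matrices; the
topology is the quotient topology along this map. -/
noncomputable instance (n : ℕ) : TopologicalSpace (CompleteFlag n) :=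
  TopologicalSpace.coinduced (fun g : GL (Fin n) ℂ => g • standardFlag n) (zariskiGL n)

/-- The diagonal matrix with `p` entries `1` followed by `q` entries `-1`. -/
def signMatrix (p q : ℕ) : Matrix (Fin (p + q)) (Fin (p + q)) ℂ :=
  Matrix.diagonal fun k => if (k : ℕ) < p then 1 else -1

/-- A matrix vanishes outside of the `p × p` upper-left block and the `q × q` lower-right block if and
only if it commutes with `signMatrix p q`. -/
theorem block_iff_commute (p q : ℕ) (A : Matrix (Fin (p + q)) (Fin (p + q)) ℂ) :
    (∀ k l : Fin (p + q), ¬ ((k : ℕ) < p ↔ (l : ℕ) < p) → A k l = 0) ↔ Commute A (signMatrix p q) := by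
  unfold Commute SemiconjBy signMatrix
  rw [← Matrix.ext_iff]
  refine forall_congr' fun k => forall_congr' fun l => ?_
  rw [Matrix.mul_diagonal, Matrix.diagonal_mul]
  by_cases hk : (k : ℕ) < p <;> by_cases hl : (l : ℕ) < p <;> simp [hk, hl]
  · exact neg_eq_self.symm
  · exact self_eq_neg.symm

/-- The symmetric subgroup `K = GL_p × GL_q` of `GL_{p+q}`: the invertible matrices that vanish
outside of the `p × p` upper-left block and the `q × q` lower-right block. -/
def K (p q : ℕ) : Subgroup (GL (Fin (p + q)) ℂ) where
  carrier := {g | ∀ k l : Fin (p + q), ¬ ((k : ℕ) < p ↔ (l : ℕ) < p) →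
    (g : Matrix (Fin (p + q)) (Fin (p + q)) ℂ) k l = 0}
  one_mem' := (block_iff_commute p q _).2 (Commute.one_left _)
  mul_mem' ha hb := (block_iff_commute p q _).2
    (((block_iff_commute p q _).1 ha).mul_left ((block_iff_commute p q _).1 hb))
  inv_mem' ha := (block_iff_commute p q _).2 (((block_iff_commute p q _).1 ha).units_inv_left)

/-- `E_p`: the span of the first `p` standard basis vectors of `ℂ^{p+q}`. -/
def E (p q : ℕ) : Submodule ℂ (Fin (p + q) → ℂ) :=
  Submodule.span ℂ ((fun k : Fin (p + q) => (Pi.single k 1 : Fin (p + q) → ℂ)) '' {k | (k : ℕ) < p})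

/-- `Ẽ_q`: the span of the last `q` standard basis vectors of `ℂ^{p+q}`. -/
def E' (p q : ℕ) : Submodule ℂ (Fin (p + q) → ℂ) :=
  Submodule.span ℂ ((fun k : Fin (p + q) => (Pi.single k 1 : Fin (p + q) → ℂ)) '' {k | p ≤ (k : ℕ)})

/-- `π`: the projection of `ℂ^{p+q}` onto `E_p` (along `Ẽ_q`), as an endomorphism of `ℂ^{p+q}`. -/
def proj (p q : ℕ) : (Fin (p + q) → ℂ) →ₗ[ℂ] (Fin (p + q) → ℂ) where
  toFun v k := if (k : ℕ) < p then v k else 0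
  map_add' v w := by
    funext k
    by_cases h : (k : ℕ) < p <;> simp [h]
  map_smul' c v := by
    funext k
    by_cases h : (k : ℕ) < p <;> simp [h]

/-- `Q_γ`: the set of all flags `F` with `dim (F_i ∩ E_p) = γ(i; +)`, `dim (F_i ∩ Ẽ_q) = γ(i; -)` and
`dim (π(F_i) + F_j) = j + γ(i; j)` for all `i`, respectively all `i < j`. (For `i = 0` the conditions
hold for every flag.) -/
def Q {p q : ℕ} (γ : Clan p q) : Set (CompleteFlag (p + q)) :=
  {F | (∀ i, finrank ℂ ↥(F.space i ⊓ E p q) = γ.rankPlus i) ∧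
    (∀ i, finrank ℂ ↥(F.space i ⊓ E' p q) = γ.rankMinus i) ∧
    ∀ i j, i < j →
      finrank ℂ ↥((F.space i).map (proj p q) ⊔ F.space j) = (j : ℕ) + γ.rankCross i j}

/-- `Y_γ`: the closure of `Q_γ` in the flag variety. -/
def Y {p q : ℕ} (γ : Clan p q) : Set (CompleteFlag (p + q)) :=
  closure (Q γ)

end ClanOrbits

/-! Both statements follow by induction along descents of clans. A descent alters a clan at two
neighbouring positions `m`, `m + 1`. Either the two characters are interchanged, when the second
closes a pair opened before `m` and the first does not, or a pair occupying exactly these positions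
is replaced by `+ -`. The rank numbers change only at level `m + 1`, where `γ'(m+1; m+1) < γ(m+1;
m+1)`, so repeated descents end at a clan of signs alone. Geometrically, `γ` and `γ'` are compared
along the projective line of flags that agree away from level `m + 1`.

The single orbit is obtained through adapted bases (`IsAdaptedBasis`): bases compatible with the
flag on which `π` fixes the vectors at a `+` or a closing position, kills those at a `-`, and sends
the vector of an opening position to that of its mate. A linear map carrying one adapted basis to
another commutes with `π`, hence lies in `K`, so flags with adapted bases form one orbit. They lie
in `Q γ` because all the spaces involved are spanned by subsets of the basis. The converse,
`Q_eq_adaptedFlags`, transports adapted bases upwards along a descent.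

For the closure, the rank inequalities are determinantal conditions, so they define a closed set
(`isClosed_rankLocus`). The substance is that every flag satisfying them is a limit of flags in `Q
γ`. The key is `exists_direction`: level `m + 1` of a flag in `rankLocus γ` can be moved so that the
inequalities of `γ'` hold. Conversely, almost every flag on the line through a flag of `Q γ'` lies
in `Q γ`. Lifted to `GL_n`, the line is swept out by transvections, and a polynomial that vanishes
for infinitely many parameters vanishes for all. This carries density from `γ'` to `γ`
(`mem_zariskiClosure_of_mem_rankLocus`). For a clan of signs alone, the inequalities already force
an adapted basis. -/

namespace ClanOrbits

open Module
open scoped Matrix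

/-! ### Combinatorics of clans: rank numbers and elementary modifications. -/

section

namespace Clan

variable {p q : ℕ} (γ : Clan p q)

/-- The positions carrying a `+` or the second member of a pair. -/
abbrev PlusOrClosing (k : Fin (p + q)) : Prop := k ∈ γ.plus ∨ γ.inv k < k

/-- The positions carrying a `-` or the second member of a pair. -/
abbrev MinusOrClosing (k : Fin (p + q)) : Prop := k ∈ γ.minus ∨ γ.inv k < k

lemma inv_eq_comm {k l : Fin (p + q)} : γ.inv k = l ↔ γ.inv l = k := by
  constructor <;> (rintro rfl; exact γ.inv_inv _)

lemma inv_eq_of_mem_plus {k : Fin (p + q)} (h : k ∈ γ.plus) : γ.inv k = k :=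
  (γ.fixed_iff k).2 (Or.inl h)

lemma inv_eq_of_mem_minus {k : Fin (p + q)} (h : k ∈ γ.minus) : γ.inv k = k :=
  (γ.fixed_iff k).2 (Or.inr h)

lemma notMem_minus_of_mem_plus {k : Fin (p + q)} (h : k ∈ γ.plus) : k ∉ γ.minus :=
  fun h' => Finset.disjoint_left.1 γ.disjoint h h'

/-- Counting a pair through its second member turns both rank numbers into counts of positions below
`i` with a property independent of `i`. -/
lemma pairsUpTo_eq (i : ℕ) :
    γ.pairsUpTo i = (Finset.univ.filter fun k : Fin (p + q) => (k : ℕ) < i ∧ γ.inv k < k).card := by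
  unfold pairsUpTo
  refine Finset.card_bij (fun s _ => γ.inv s) ?_ ?_ ?_
  · intro s hs
    simp only [Finset.mem_filter, Finset.mem_univ, true_and] at hs ⊢
    rw [γ.inv_inv]
    exact ⟨hs.2, hs.1⟩
  · intro s _ t _ h
    exact γ.inv.injective h
  · intro k hk
    simp only [Finset.mem_filter, Finset.mem_univ, true_and] at hk
    refine ⟨γ.inv k, ?_, γ.inv_inv k⟩
    simp only [Finset.mem_filter, Finset.mem_univ, true_and]
    rw [γ.inv_inv]
    exact ⟨hk.2, hk.1⟩

lemma rankPlus_eq (i : ℕ) : γ.rankPlus i =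
    (Finset.univ.filter fun k : Fin (p + q) => (k : ℕ) < i ∧ γ.PlusOrClosing k).card := by
  unfold rankPlus
  rw [pairsUpTo_eq, ← Finset.card_union_of_disjoint]
  · congr 1
    ext k
    simp only [Finset.mem_union, Finset.mem_filter, Finset.mem_univ, true_and]
    tauto
  · rw [Finset.disjoint_left]
    intro k hk hk'
    simp only [Finset.mem_filter, Finset.mem_univ, true_and] at hk hk'
    exact hk'.2.ne (γ.inv_eq_of_mem_plus hk.1)

lemma rankMinus_eq (i : ℕ) : γ.rankMinus i =
    (Finset.univ.filter fun k : Fin (p + q) => (k : ℕ) < i ∧ γ.MinusOrClosing k).card := by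
  unfold rankMinus
  rw [pairsUpTo_eq, ← Finset.card_union_of_disjoint]
  · congr 1
    ext k
    simp only [Finset.mem_union, Finset.mem_filter, Finset.mem_univ, true_and]
    tauto
  · rw [Finset.disjoint_left]
    intro k hk hk'
    simp only [Finset.mem_filter, Finset.mem_univ, true_and] at hk hk'
    exact hk'.2.ne (γ.inv_eq_of_mem_minus hk.1)

end Clan

lemma card_filter_lt_mono {n : ℕ} (P : Fin n → Prop) [DecidablePred P] {i j : ℕ} (h : i ≤ j) :
    (Finset.univ.filter fun k : Fin n => (k : ℕ) < i ∧ P k).card ≤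
      (Finset.univ.filter fun k : Fin n => (k : ℕ) < j ∧ P k).card := by
  refine Finset.card_le_card fun k hk => ?_
  simp only [Finset.mem_filter, Finset.mem_univ, true_and] at hk ⊢
  exact ⟨hk.1.trans_le h, hk.2⟩

lemma card_filter_lt_succ_le {n : ℕ} (P : Fin n → Prop) [DecidablePred P] (i : ℕ) :
    (Finset.univ.filter fun k : Fin n => (k : ℕ) < i + 1 ∧ P k).card ≤
      (Finset.univ.filter fun k : Fin n => (k : ℕ) < i ∧ P k).card + 1 := by
  by_cases hi : i < n
  · refine (Finset.card_le_card (t := (Finset.univ.filter fun k : Fin n => (k : ℕ) < i ∧ P k) ∪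
      {⟨i, hi⟩}) fun k hk => ?_).trans (Finset.card_union_le _ _)
    simp only [Finset.mem_filter, Finset.mem_univ, true_and, Finset.mem_union,
      Finset.mem_singleton, Fin.ext_iff] at hk ⊢
    by_cases h : (k : ℕ) < i
    · exact Or.inl ⟨h, hk.2⟩
    · right; omega
  · refine (Finset.card_le_card fun k hk => ?_).trans (Nat.le_succ _)
    simp only [Finset.mem_filter, Finset.mem_univ, true_and] at hk ⊢
    exact ⟨by omega, hk.2⟩

namespace Clan

variable {p q : ℕ} (γ : Clan p q)

lemma rankPlus_mono {i j : ℕ} (h : i ≤ j) : γ.rankPlus i ≤ γ.rankPlus j := by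
  rw [rankPlus_eq, rankPlus_eq]; exact card_filter_lt_mono _ h

lemma rankMinus_mono {i j : ℕ} (h : i ≤ j) : γ.rankMinus i ≤ γ.rankMinus j := by
  rw [rankMinus_eq, rankMinus_eq]; exact card_filter_lt_mono _ h

lemma rankPlus_succ_le (i : ℕ) : γ.rankPlus (i + 1) ≤ γ.rankPlus i + 1 := by
  rw [rankPlus_eq, rankPlus_eq]; exact card_filter_lt_succ_le _ i

lemma rankMinus_succ_le (i : ℕ) : γ.rankMinus (i + 1) ≤ γ.rankMinus i + 1 := by
  rw [rankMinus_eq, rankMinus_eq]; exact card_filter_lt_succ_le _ i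

lemma rankCross_le_left_succ (i j : ℕ) : γ.rankCross (i + 1) j ≤ γ.rankCross i j + 1 :=
  card_filter_lt_succ_le (fun s => j ≤ (γ.inv s : ℕ)) i

lemma rankCross_le_right_succ (i j : ℕ) : γ.rankCross i j ≤ γ.rankCross i (j + 1) + 1 := by
  unfold rankCross
  by_cases hj : j < p + q
  · refine (Finset.card_le_card (t := (Finset.univ.filter fun s : Fin (p + q) =>
      (s : ℕ) < i ∧ j + 1 ≤ (γ.inv s : ℕ)) ∪ {γ.inv ⟨j, hj⟩}) fun k hk => ?_).trans
      (Finset.card_union_le _ _)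
    simp only [Finset.mem_filter, Finset.mem_univ, true_and, Finset.mem_union,
      Finset.mem_singleton] at hk ⊢
    by_cases h : j + 1 ≤ (γ.inv k : ℕ)
    · exact Or.inl ⟨hk.1, h⟩
    · right
      rw [eq_comm, γ.inv_eq_comm, Fin.ext_iff]
      simp only
      omega
  · refine (Finset.card_le_card fun k hk => ?_).trans (Nat.le_succ _)
    simp only [Finset.mem_filter, Finset.mem_univ, true_and] at hk
    exact absurd (γ.inv k).2 (by omega)

lemma rankPlus_succ (k : Fin (p + q)) :
    γ.rankPlus (k + 1) = γ.rankPlus k + if γ.PlusOrClosing k then 1 else 0 := by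
  rw [rankPlus_eq, rankPlus_eq]
  split_ifs with h
  · rw [← Finset.card_insert_of_notMem (a := k) (by simp)]
    congr 1
    ext l
    simp only [Finset.mem_filter, Finset.mem_univ, true_and, Finset.mem_insert, Fin.ext_iff]
    constructor
    · rintro ⟨h1, h2⟩
      by_cases h3 : (l : ℕ) = k
      · exact Or.inl h3
      · exact Or.inr ⟨by omega, h2⟩
    · rintro (h1 | ⟨h1, h2⟩)
      · rw [← Fin.ext_iff] at h1; subst h1; exact ⟨by omega, h⟩
      · exact ⟨by omega, h2⟩
  · rw [add_zero]
    congr 1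
    ext l
    simp only [Finset.mem_filter, Finset.mem_univ, true_and]
    refine ⟨fun ⟨h1, h2⟩ => ⟨?_, h2⟩, fun ⟨h1, h2⟩ => ⟨by omega, h2⟩⟩
    by_contra h3
    have : l = k := Fin.ext (by omega)
    exact h (this ▸ h2)

lemma rankMinus_succ (k : Fin (p + q)) :
    γ.rankMinus (k + 1) = γ.rankMinus k + if γ.MinusOrClosing k then 1 else 0 := by
  rw [rankMinus_eq, rankMinus_eq]
  split_ifs with h
  · rw [← Finset.card_insert_of_notMem (a := k) (by simp)]
    congr 1
    ext l
    simp only [Finset.mem_filter, Finset.mem_univ, true_and, Finset.mem_insert, Fin.ext_iff]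
    constructor
    · rintro ⟨h1, h2⟩
      by_cases h3 : (l : ℕ) = k
      · exact Or.inl h3
      · exact Or.inr ⟨by omega, h2⟩
    · rintro (h1 | ⟨h1, h2⟩)
      · rw [← Fin.ext_iff] at h1; subst h1; exact ⟨by omega, h⟩
      · exact ⟨by omega, h2⟩
  · rw [add_zero]
    congr 1
    ext l
    simp only [Finset.mem_filter, Finset.mem_univ, true_and]
    refine ⟨fun ⟨h1, h2⟩ => ⟨?_, h2⟩, fun ⟨h1, h2⟩ => ⟨by omega, h2⟩⟩
    by_contra h3
    have : l = k := Fin.ext (by omega)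
    exact h (this ▸ h2)

/-- Each of the first `i` positions is a `+` or closes a pair, is a `-` or opens a pair that is closed
among the first `i` positions, or opens a pair that is still open. -/
lemma rankPlus_add_rankMinus_add_rankCross {i : ℕ} (hi : i ≤ p + q) :
    γ.rankPlus i + γ.rankMinus i + γ.rankCross i i = i := by
  have h1 := γ.rankPlus_eq i
  have h2 : γ.rankMinus i = (Finset.univ.filter fun k : Fin (p + q) =>
      (k : ℕ) < i ∧ (k ∈ γ.minus ∨ (k < γ.inv k ∧ (γ.inv k : ℕ) < i))).card := by
    unfold rankMinus pairsUpTo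
    rw [← Finset.card_union_of_disjoint]
    · congr 1
      ext k
      simp only [Finset.mem_union, Finset.mem_filter, Finset.mem_univ, true_and]
      constructor
      · rintro (h | h)
        · tauto
        · exact ⟨lt_trans (Fin.lt_def.1 h.1) h.2, Or.inr h⟩
      · tauto
    · rw [Finset.disjoint_left]
      intro k hk hk'
      simp only [Finset.mem_filter, Finset.mem_univ, true_and] at hk hk'
      exact hk'.1.ne' (γ.inv_eq_of_mem_minus hk.1)
  rw [h1, h2]
  unfold rankCross
  rw [← Finset.card_union_of_disjoint, ← Finset.card_union_of_disjoint]
  · have h3 : (Finset.univ.filter fun k : Fin (p + q) => (k : ℕ) < i).card = i := by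
      rw [Fin.card_filter_val_lt]; exact min_eq_right hi
    conv_rhs => rw [← h3]
    congr 1
    ext k
    simp only [Finset.mem_union, Finset.mem_filter, Finset.mem_univ, true_and]
    have h4 := γ.fixed_iff k
    rcases lt_trichotomy (γ.inv k) k with h | h | h
    · tauto
    · tauto
    · have := lt_or_ge (γ.inv k : ℕ) i
      tauto
  · rw [Finset.disjoint_left]
    intro k hk hk'
    simp only [Finset.mem_union, Finset.mem_filter, Finset.mem_univ, true_and] at hk hk'
    rcases hk with ⟨h1, h | h⟩ | ⟨h1, h | h⟩
    · have := γ.inv_eq_of_mem_plus h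
      rw [this] at hk'; omega
    · rw [Fin.lt_def] at h; omega
    · have := γ.inv_eq_of_mem_minus h
      rw [this] at hk'; omega
    · omega
  · rw [Finset.disjoint_left]
    intro k hk hk'
    simp only [Finset.mem_filter, Finset.mem_univ, true_and] at hk hk'
    rcases hk with ⟨h1, h | h⟩ <;> rcases hk' with ⟨h1', h' | h'⟩
    · exact γ.notMem_minus_of_mem_plus h h'
    · exact h'.1.ne' (γ.inv_eq_of_mem_plus h)
    · exact h.ne (γ.inv_eq_of_mem_minus h')
    · exact lt_asymm h h'.1

/-- The level `m + 1` is replaced by the level `m`. -/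
def lowerLevel (m i : ℕ) : ℕ := if i = m + 1 then m else i

/-- The level `m + 1` is replaced by the level `m + 2`. -/
def upperLevel (m j : ℕ) : ℕ := if j = m + 1 then m + 2 else j

/-- The rank numbers of `γ'` are those of the clan obtained from `γ` by a descent at the positions `m`
and `m + 1`. -/
structure IsDescent (m : ℕ) (γ' γ : Clan p q) : Prop where
  lt : m + 1 < p + q
  rankPlus : ∀ i, i ≠ m + 1 → γ'.rankPlus i = γ.rankPlus i
  rankMinus : ∀ i, i ≠ m + 1 → γ'.rankMinus i = γ.rankMinus i
  rankCross : ∀ i j, i ≤ j → γ'.rankCross i j = γ.rankCross (lowerLevel m i) (upperLevel m j)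
  rankCross_lt : γ'.rankCross (m + 1) (m + 1) < γ.rankCross (m + 1) (m + 1)

/-- The clan with the characters at two positions interchanged. -/
def swap (γ : Clan p q) (k l : Fin (p + q)) : Clan p q where
  inv := Equiv.swap k l * γ.inv * Equiv.swap k l
  inv_inv x := by simp [γ.inv_inv]
  plus := γ.plus.map (Equiv.swap k l).toEmbedding
  minus := γ.minus.map (Equiv.swap k l).toEmbedding
  fixed_iff x := by
    simp only [Equiv.Perm.coe_mul, Function.comp_apply, Finset.mem_map_equiv, Equiv.symm_swap]
    rw [← γ.fixed_iff, ← Equiv.apply_eq_iff_eq (Equiv.swap k l), Equiv.swap_apply_self]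
  disjoint := (Finset.disjoint_map _).2 γ.disjoint
  signature := by simpa using γ.signature

lemma swap_inv_apply (k l x : Fin (p + q)) :
    (γ.swap k l).inv x = Equiv.swap k l (γ.inv (Equiv.swap k l x)) := rfl

lemma mem_swap_plus (k l x : Fin (p + q)) :
    x ∈ (γ.swap k l).plus ↔ Equiv.swap k l x ∈ γ.plus := by
  simp [swap, Finset.mem_map_equiv]

lemma mem_swap_minus (k l x : Fin (p + q)) :
    x ∈ (γ.swap k l).minus ↔ Equiv.swap k l x ∈ γ.minus := by
  simp [swap, Finset.mem_map_equiv]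

/-- The clan with the pair at the positions `k`, `l` replaced by `+` at `k` and `-` at `l`. -/
def splitPair (γ : Clan p q) (k l : Fin (p + q)) (h : γ.inv k = l) (hkl : k ≠ l) : Clan p q where
  inv := Equiv.swap k l * γ.inv
  inv_inv x := by
    have h' : γ.inv l = k := γ.inv_eq_comm.1 h
    simp only [Equiv.Perm.coe_mul, Function.comp_apply]
    by_cases h1 : x = k
    · subst h1; simp [h]
    by_cases h2 : x = l
    · subst h2; simp [h']
    have h3 : γ.inv x ≠ k := fun e => h2 (by rw [← h, ← e, γ.inv_inv])
    have h4 : γ.inv x ≠ l := fun e => h1 (by rw [← h', ← e, γ.inv_inv])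
    rw [Equiv.swap_apply_of_ne_of_ne h3 h4, γ.inv_inv, Equiv.swap_apply_of_ne_of_ne h1 h2]
  plus := insert k γ.plus
  minus := insert l γ.minus
  fixed_iff x := by
    have h' : γ.inv l = k := γ.inv_eq_comm.1 h
    simp only [Equiv.Perm.coe_mul, Function.comp_apply, Finset.mem_insert]
    by_cases h1 : x = k
    · subst h1; simp [h]
    by_cases h2 : x = l
    · subst h2; simp [h']
    have h3 : γ.inv x ≠ k := fun e => h2 (by rw [← h, ← e, γ.inv_inv])
    have h4 : γ.inv x ≠ l := fun e => h1 (by rw [← h', ← e, γ.inv_inv])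
    rw [Equiv.swap_apply_of_ne_of_ne h3 h4, γ.fixed_iff]
    simp [h1, h2]
  disjoint := by
    have h' : γ.inv l = k := γ.inv_eq_comm.1 h
    rw [Finset.disjoint_insert_left, Finset.disjoint_insert_right, Finset.mem_insert]
    refine ⟨?_, ?_, γ.disjoint⟩
    · rintro (h1 | h1)
      · exact hkl h1
      · exact hkl ((γ.inv_eq_of_mem_minus h1).symm.trans h)
    · intro h1
      exact hkl (h'.symm.trans (γ.inv_eq_of_mem_plus h1))
  signature := by
    have h' : γ.inv l = k := γ.inv_eq_comm.1 h
    rw [Finset.card_insert_of_notMem, Finset.card_insert_of_notMem]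
    · push_cast; linarith [γ.signature]
    · exact fun h1 => hkl (h'.symm.trans (γ.inv_eq_of_mem_minus h1))
    · exact fun h1 => hkl ((γ.inv_eq_of_mem_plus h1).symm.trans h)

end Clan

end

/-! ### Descents of clans. -/

section

namespace Clan

variable {p q : ℕ} (γ : Clan p q)

lemma val_swap {n : ℕ} (k l x : Fin n) : (Equiv.swap k l x : ℕ) =
    if (x : ℕ) = k then (l : ℕ) else if (x : ℕ) = l then (k : ℕ) else x := by
  rw [Equiv.swap_apply_def]
  simp only [Fin.ext_iff]
  split_ifs <;> rfl

/-- The transposition matches the positions of the two clans. As `k` and `l` are not mates, no pair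
has its two ends reversed, so closing positions correspond to closing positions; and a bound on
positions notices the transposition only at level `m + 1`. -/
lemma isDescent_swap {m : ℕ} {k l : Fin (p + q)} (hk : (k : ℕ) = m) (hl : (l : ℕ) = m + 1)
    (h1 : (γ.inv l : ℕ) < m) (h2 : m ≤ (γ.inv k : ℕ)) : IsDescent m (γ.swap k l) γ := by
  have e1 : ∀ x : Fin (p + q), (x : ℕ) = m + 1 → (γ.inv x : ℕ) < m := by
    intro x hx
    obtain rfl : x = l := Fin.ext (hx.trans hl.symm)
    exact h1
  have e2 : ∀ x : Fin (p + q), (x : ℕ) = m → m ≤ (γ.inv x : ℕ) := by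
    intro x hx
    obtain rfl : x = k := Fin.ext (hx.trans hk.symm)
    exact h2
  have e1' : ∀ x : Fin (p + q), (γ.inv x : ℕ) = m + 1 → (x : ℕ) < m := by
    intro x hx
    simpa [γ.inv_inv] using e1 _ hx
  have e2' : ∀ x : Fin (p + q), (γ.inv x : ℕ) = m → m ≤ (x : ℕ) := by
    intro x hx
    simpa [γ.inv_inv] using e2 _ hx
  have hσ : ∀ x, (Equiv.swap k l x : ℕ) =
      if (x : ℕ) = m then m + 1 else if (x : ℕ) = m + 1 then m else x := by
    intro x; rw [val_swap, hk, hl]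
  have hcl : ∀ x, (γ.swap k l).inv (Equiv.swap k l x) < Equiv.swap k l x ↔ γ.inv x < x := by
    intro x
    rw [swap_inv_apply, Equiv.swap_apply_self, Fin.lt_def, Fin.lt_def, hσ, hσ]
    have := e1 x; have := e2 x; have := e1' x; have := e2' x
    split_ifs <;> omega
  refine ⟨by omega, fun i hi => ?_, fun i hi => ?_, fun i j hij => ?_, ?_⟩
  · rw [rankPlus_eq, rankPlus_eq]
    refine (Finset.card_equiv (Equiv.swap k l) fun x => ?_).symm
    simp only [Finset.mem_filter, Finset.mem_univ, true_and]
    unfold PlusOrClosing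
    rw [hcl, mem_swap_plus, Equiv.swap_apply_self, hσ]
    refine and_congr_left fun _ => ?_
    split_ifs <;> omega
  · rw [rankMinus_eq, rankMinus_eq]
    refine (Finset.card_equiv (Equiv.swap k l) fun x => ?_).symm
    simp only [Finset.mem_filter, Finset.mem_univ, true_and]
    unfold MinusOrClosing
    rw [hcl, mem_swap_minus, Equiv.swap_apply_self, hσ]
    refine and_congr_left fun _ => ?_
    split_ifs <;> omega
  · unfold rankCross
    refine (Finset.card_equiv (Equiv.swap k l) fun x => ?_).symm
    simp only [Finset.mem_filter, Finset.mem_univ, true_and]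
    rw [swap_inv_apply, Equiv.swap_apply_self, hσ, hσ]
    unfold lowerLevel upperLevel
    have := e1 x; have := e2 x; have := e1' x; have := e2' x
    split_ifs <;> omega
  · unfold rankCross
    refine Finset.card_lt_card ⟨fun x hx => ?_, fun hsub => ?_⟩
    · simp only [Finset.mem_filter, Finset.mem_univ, true_and] at hx ⊢
      rw [swap_inv_apply, hσ] at hx
      have hx0 := hσ x
      have a1 := e1 (Equiv.swap k l x)
      have a2 := e2 (Equiv.swap k l x)
      have a3 := e2' (Equiv.swap k l x)
      by_cases hxm : (x : ℕ) = m
      · rw [if_pos hxm] at hx0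
        have := a1 hx0
        split_ifs at hx <;> omega
      · have hx2 : Equiv.swap k l x = x := by
          apply Fin.ext; rw [hx0, if_neg hxm, if_neg (by omega)]
        rw [hx2] at hx a1 a2 a3
        split_ifs at hx <;> omega
    -- Strictness: the pair closed at `l` is open at level `m + 1` for `γ`, but already closed after
    -- its second end has moved to `k`.
    · have h3 : γ.inv l ∈ Finset.univ.filter fun s : Fin (p + q) =>
          (s : ℕ) < m + 1 ∧ m + 1 ≤ (γ.inv s : ℕ) := by
        simp only [Finset.mem_filter, Finset.mem_univ, true_and, γ.inv_inv]
        omega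
      have h4 := hsub h3
      simp only [Finset.mem_filter, Finset.mem_univ, true_and] at h4
      have h5 : Equiv.swap k l (γ.inv l) = γ.inv l := by
        apply Fin.ext; rw [hσ, if_neg (by omega), if_neg (by omega)]
      rw [swap_inv_apply, h5, γ.inv_inv, Equiv.swap_apply_right] at h4
      omega

lemma splitPair_inv_apply {k l : Fin (p + q)} (h : γ.inv k = l) (hkl : k ≠ l) (x : Fin (p + q)) :
    (γ.splitPair k l h hkl).inv x = if x = k ∨ x = l then x else γ.inv x := by
  have h' : γ.inv l = k := γ.inv_eq_comm.1 h
  simp only [splitPair, Equiv.Perm.coe_mul, Function.comp_apply]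
  split_ifs with h1
  · rcases h1 with rfl | rfl
    · rw [h, Equiv.swap_apply_right]
    · rw [h', Equiv.swap_apply_left]
  · push Not at h1
    rw [Equiv.swap_apply_of_ne_of_ne]
    · exact fun e => h1.2 (by rw [← h, ← e, γ.inv_inv])
    · exact fun e => h1.1 (by rw [← h', ← e, γ.inv_inv])

/-- The closing position `l` counted for both signs. After splitting, its contribution to the `+`
count sits at `k`, while its contribution to the `-` count stays at `l`; so only the `+` count needs
the transposition. The lost pair was open at level `m + 1` only. -/
lemma isDescent_splitPair {m : ℕ} {k l : Fin (p + q)} (hkv : (k : ℕ) = m)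
    (hlv : (l : ℕ) = m + 1) (h : γ.inv k = l) (hkl : k ≠ l) :
    IsDescent m (γ.splitPair k l h hkl) γ := by
  have h' : γ.inv l = k := γ.inv_eq_comm.1 h
  have hinv := γ.splitPair_inv_apply h hkl
  have hplus : ∀ x, x ∈ (γ.splitPair k l h hkl).plus ↔ x = k ∨ x ∈ γ.plus := by
    intro x; simp [splitPair]
  have hminus : ∀ x, x ∈ (γ.splitPair k l h hkl).minus ↔ x = l ∨ x ∈ γ.minus := by
    intro x; simp [splitPair]
  have hkp : k ∉ γ.plus := fun h1 => hkl ((γ.inv_eq_of_mem_plus h1).symm.trans h)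
  have hkm : k ∉ γ.minus := fun h1 => hkl ((γ.inv_eq_of_mem_minus h1).symm.trans h)
  have hlp : l ∉ γ.plus := fun h1 => hkl (h'.symm.trans (γ.inv_eq_of_mem_plus h1))
  have hlm : l ∉ γ.minus := fun h1 => hkl (h'.symm.trans (γ.inv_eq_of_mem_minus h1))
  refine ⟨by omega, fun i hi => ?_, fun i hi => ?_, fun i j hij => ?_, ?_⟩
  · rw [rankPlus_eq, rankPlus_eq]
    refine (Finset.card_equiv (Equiv.swap k l) fun x => ?_).symm
    simp only [Finset.mem_filter, Finset.mem_univ, true_and]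
    unfold PlusOrClosing
    rw [hplus, hinv]
    by_cases hxk : x = k
    · subst hxk
      rw [Equiv.swap_apply_left]
      simp [hkp, hlp, hkl.symm, h, Fin.lt_def, hkv, hlv]
    by_cases hxl : x = l
    · subst hxl
      rw [Equiv.swap_apply_right]
      simp [h', Fin.lt_def, hkv, hlv]
      omega
    rw [Equiv.swap_apply_of_ne_of_ne hxk hxl]
    simp [hxk, hxl]
  · rw [rankMinus_eq, rankMinus_eq]
    congr 1
    ext x
    simp only [Finset.mem_filter, Finset.mem_univ, true_and]
    unfold MinusOrClosing
    rw [hminus, hinv]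
    refine and_congr_right fun _ => ?_
    by_cases hxk : x = k
    · subst hxk
      simp [hkm, hkl, h, Fin.lt_def, hkv, hlv]
    by_cases hxl : x = l
    · subst hxl
      simp [h', Fin.lt_def, hkv, hlv]
    simp [hxk, hxl]
  · unfold rankCross
    congr 1
    ext x
    simp only [Finset.mem_filter, Finset.mem_univ, true_and]
    rw [hinv]
    unfold lowerLevel upperLevel
    by_cases hxk : x = k
    · subst hxk
      simp only [true_or, if_true, h, hkv, hlv]
      split_ifs <;> omega
    by_cases hxl : x = l
    · subst hxl
      simp only [or_true, if_true, h', hkv, hlv]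
      split_ifs <;> omega
    have hx1 : (γ.inv x : ℕ) ≠ m := fun e => hxl (by
      rw [← h, ← show γ.inv x = k from Fin.ext (e.trans hkv.symm), γ.inv_inv])
    have hx2 : (γ.inv x : ℕ) ≠ m + 1 := fun e => hxk (by
      rw [← h', ← show γ.inv x = l from Fin.ext (e.trans hlv.symm), γ.inv_inv])
    have hx3 : (x : ℕ) ≠ m := fun e => hxk (Fin.ext (e.trans hkv.symm))
    have hx4 : (x : ℕ) ≠ m + 1 := fun e => hxl (Fin.ext (e.trans hlv.symm))
    simp only [hxk, hxl, or_self, if_false]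
    split_ifs <;> omega
  · unfold rankCross
    refine Finset.card_lt_card ⟨fun x hx => ?_, fun hsub => ?_⟩
    · simp only [Finset.mem_filter, Finset.mem_univ, true_and] at hx ⊢
      rw [hinv] at hx
      split_ifs at hx <;> omega
    · have h3 : k ∈ Finset.univ.filter fun s : Fin (p + q) =>
          (s : ℕ) < m + 1 ∧ m + 1 ≤ (γ.inv s : ℕ) := by
        simp only [Finset.mem_filter, Finset.mem_univ, true_and, h, hkv, hlv]
        exact ⟨by omega, le_rfl⟩
      have h4 := hsub h3
      simp only [Finset.mem_filter, Finset.mem_univ, true_and, hinv, true_or, if_true, hkv] at h4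
      omega

/-- A clan without pairs consists of signs; otherwise the first position closing a pair is preceded by
its mate, by a sign or by a position opening another pair. -/
lemma forall_inv_eq_or_exists_descent :
    (∀ k, γ.inv k = k) ∨
    ∃ (m : ℕ) (k l : Fin (p + q)), (k : ℕ) = m ∧ (l : ℕ) = m + 1 ∧
      (γ.inv k = l ∨ ((γ.inv l : ℕ) < m ∧ m ≤ (γ.inv k : ℕ))) := by
  by_cases h : ∃ i : ℕ, ∃ hi : i < p + q, (γ.inv ⟨i, hi⟩ : ℕ) < i
  · right
    classical
    -- The first closing position is `m + 1`. By minimality position `m` is not closing, so either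
    -- it is the mate of `m + 1` or the mate lies before `m`.
    obtain ⟨hi, h1⟩ := Nat.find_spec h
    have hmin : ∀ j, j < Nat.find h → ¬ ∃ hj : j < p + q, (γ.inv ⟨j, hj⟩ : ℕ) < j :=
      fun j hj => Nat.find_min h hj
    generalize Nat.find h = i at hi h1 hmin
    obtain ⟨m, rfl⟩ : ∃ m, i = m + 1 := ⟨i - 1, by omega⟩
    refine ⟨m, ⟨m, by omega⟩, ⟨m + 1, hi⟩, rfl, rfl, ?_⟩
    have h2 : m ≤ (γ.inv ⟨m, by omega⟩ : ℕ) := by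
      by_contra hc
      exact hmin m (by omega) ⟨by omega, by omega⟩
    by_cases h3 : (γ.inv ⟨m + 1, hi⟩ : ℕ) = m
    · left
      rw [γ.inv_eq_comm]
      exact Fin.ext h3
    · right
      exact ⟨by omega, h2⟩
  · left
    push Not at h
    intro k
    apply le_antisymm
    · have := h (γ.inv k) (γ.inv k).2
      rw [Fin.eta, γ.inv_inv] at this
      exact this
    · exact h k k.2

/-- The induction measure: among the diagonal terms only the one at `m + 1` changes, and it drops.
-/
lemma IsDescent.sum_rankCross_lt {γ' γ : Clan p q} {m : ℕ} (h : IsDescent m γ' γ) :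
    ∑ i ∈ Finset.range (p + q), γ'.rankCross i i < ∑ i ∈ Finset.range (p + q), γ.rankCross i i := by
  refine Finset.sum_lt_sum (fun i _ => ?_) ⟨m + 1, Finset.mem_range.2 h.lt, h.rankCross_lt⟩
  by_cases hi : i = m + 1
  · subst hi; exact h.rankCross_lt.le
  · rw [h.rankCross i i le_rfl]
    simp [lowerLevel, upperLevel, hi]

lemma IsDescent.rankCross_right {γ' γ : Clan p q} {m : ℕ} (h : IsDescent m γ' γ) {i : ℕ}
    (hi : i ≤ m) : γ'.rankCross i (m + 1) = γ.rankCross i (m + 2) := by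
  rw [h.rankCross _ _ (by omega)]
  simp only [lowerLevel, upperLevel, if_true]
  rw [if_neg (by omega)]

lemma IsDescent.rankCross_left {γ' γ : Clan p q} {m : ℕ} (h : IsDescent m γ' γ) {j : ℕ}
    (hj : m + 2 ≤ j) : γ'.rankCross (m + 1) j = γ.rankCross m j := by
  rw [h.rankCross _ _ (by omega)]
  simp only [lowerLevel, upperLevel, if_true]
  rw [if_neg (by omega)]

lemma IsDescent.rankCross_self {γ' γ : Clan p q} {m : ℕ} (h : IsDescent m γ' γ) :
    γ'.rankCross (m + 1) (m + 1) = γ.rankCross m (m + 2) := by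
  rw [h.rankCross _ _ le_rfl]
  simp only [lowerLevel, upperLevel, if_true]

lemma IsDescent.rankCross_of_ne {γ' γ : Clan p q} {m : ℕ} (h : IsDescent m γ' γ) {i j : ℕ}
    (hij : i ≤ j) (hi : i ≠ m + 1) (hj : j ≠ m + 1) : γ'.rankCross i j = γ.rankCross i j := by
  rw [h.rankCross _ _ hij]
  simp only [lowerLevel, upperLevel, hi, hj, if_false]

end Clan

end

/-! ### Dimension formulas, the projection, adjacent flags and rank conditions. -/

section

section LinearAlgebra

variable {𝕜 V W : Type*} [Field 𝕜] [AddCommGroup V] [Module 𝕜 V] [FiniteDimensional 𝕜 V]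
  [AddCommGroup W] [Module 𝕜 W]

lemma finrank_map_add_finrank_inf_ker (f : V →ₗ[𝕜] W) (C : Submodule 𝕜 V) :
    finrank 𝕜 (C.map f) + finrank 𝕜 ↥(C ⊓ LinearMap.ker f) = finrank 𝕜 C := by
  have h := (f.domRestrict C).finrank_range_add_finrank_ker
  rw [LinearMap.range_domRestrict, LinearMap.ker_domRestrict] at h
  rw [← h, ← Submodule.map_comap_subtype]
  congr 1
  exact (Submodule.equivMapOfInjective C.subtype C.subtype_injective _).finrank_eq.symm

/-- Rank-nullity for the composite of `C → W` with the quotient by `S`. It converts upper bounds on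
sums into lower bounds on intersections. -/
lemma finrank_map_sup_add_finrank_inf_comap [FiniteDimensional 𝕜 W] (f : V →ₗ[𝕜] W) (C : Submodule 𝕜 V)
    (S : Submodule 𝕜 W) :
    finrank 𝕜 ↥(C.map f ⊔ S) + finrank 𝕜 ↥(C ⊓ S.comap f) = finrank 𝕜 C + finrank 𝕜 S := by
  have h1 := Submodule.finrank_sup_add_finrank_inf_eq (C.map f) S
  rw [Submodule.map_inf_eq_map_inf_comap] at h1
  have h2 := finrank_map_add_finrank_inf_ker f C
  have h3 := finrank_map_add_finrank_inf_ker f (C ⊓ S.comap f)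
  have h4 : C ⊓ S.comap f ⊓ LinearMap.ker f = C ⊓ LinearMap.ker f := by
    rw [inf_assoc]
    congr 1
    exact inf_eq_right.2 (Submodule.comap_mono bot_le)
  rw [h4] at h3
  omega

lemma finrank_sup_span_singleton_le (S : Submodule 𝕜 V) (y : V) :
    finrank 𝕜 ↥(S ⊔ 𝕜 ∙ y) ≤ finrank 𝕜 S + 1 := by
  by_cases h : y ∈ S
  · rw [sup_eq_left.2 ((Submodule.span_singleton_le_iff_mem y S).2 h)]
    exact Nat.le_succ _
  · exact (Submodule.finrank_sup_span_singleton h).le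

lemma finrank_lt_finrank_of_mem {S T : Submodule 𝕜 V} (h : S ≤ T) {y : V} (hy : y ∈ T)
    (hy' : y ∉ S) : finrank 𝕜 S < finrank 𝕜 T :=
  Submodule.finrank_lt_finrank_of_lt (lt_of_le_of_ne h fun e => hy' (e ▸ hy))

lemma exists_mem_notMem_of_finrank_lt {S T : Submodule 𝕜 V} (h : finrank 𝕜 S < finrank 𝕜 T) :
    ∃ y ∈ T, y ∉ S := by
  by_contra hc
  push Not at hc
  exact absurd (Submodule.finrank_mono (show T ≤ S from hc)) (by omega)

lemma sup_span_singleton_eq_of_finrank {S T : Submodule 𝕜 V} (h : S ≤ T) {y : V} (hy : y ∈ T)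
    (hy' : y ∉ S) (hT : finrank 𝕜 T = finrank 𝕜 S + 1) : S ⊔ 𝕜 ∙ y = T :=
  Submodule.eq_of_le_of_finrank_eq
    (sup_le h ((Submodule.span_singleton_le_iff_mem y T).2 hy))
    ((Submodule.finrank_sup_span_singleton hy').trans hT.symm)

end LinearAlgebra

section Projection

variable {p q : ℕ}

lemma proj_apply (v : Fin (p + q) → ℂ) (k : Fin (p + q)) :
    proj p q v k = if (k : ℕ) < p then v k else 0 := rfl

lemma proj_proj (v : Fin (p + q) → ℂ) : proj p q (proj p q v) = proj p q v := by
  ext k; simp only [proj_apply]; split_ifs <;> rfl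

lemma mem_span_single_iff {n : ℕ} (s : Set (Fin n)) (v : Fin n → ℂ) :
    v ∈ Submodule.span ℂ ((fun k : Fin n => (Pi.single k 1 : Fin n → ℂ)) '' s) ↔
      ∀ k, k ∉ s → v k = 0 := by
  constructor
  · intro hv k hk
    induction hv using Submodule.span_induction with
    | mem x hx =>
      obtain ⟨l, hl, rfl⟩ := hx
      exact Pi.single_eq_of_ne (fun e : k = l => hk (e ▸ hl)) _
    | zero => rfl
    | add x y _ _ h1 h2 => rw [Pi.add_apply, h1, h2, add_zero]
    | smul a x _ h => rw [Pi.smul_apply, h, smul_zero]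
  · intro h
    rw [pi_eq_sum_univ' v]
    refine Submodule.sum_mem _ fun k _ => ?_
    by_cases hk : k ∈ s
    · exact Submodule.smul_mem _ _ (Submodule.subset_span ⟨k, hk, by
        ext l; simp [Pi.single_apply, eq_comm]⟩)
    · rw [h k hk, zero_smul]; exact Submodule.zero_mem _

lemma mem_E_iff {v : Fin (p + q) → ℂ} : v ∈ E p q ↔ proj p q v = v := by
  unfold E
  rw [mem_span_single_iff, funext_iff]
  refine forall_congr' fun k => ?_
  rw [proj_apply]
  split_ifs with h <;> simp [h, eq_comm]

lemma E'_eq_ker : E' p q = LinearMap.ker (proj p q) := by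
  ext v
  unfold E'
  rw [mem_span_single_iff, LinearMap.mem_ker, funext_iff]
  refine forall_congr' fun k => ?_
  rw [proj_apply]
  split_ifs with h <;> simp [h]

lemma mem_E'_iff {v : Fin (p + q) → ℂ} : v ∈ E' p q ↔ proj p q v = 0 := by
  rw [E'_eq_ker, LinearMap.mem_ker]

lemma proj_mem_E (v : Fin (p + q) → ℂ) : proj p q v ∈ E p q := mem_E_iff.2 (proj_proj v)

lemma sub_proj_mem_E' (v : Fin (p + q) → ℂ) : v - proj p q v ∈ E' p q := by
  rw [mem_E'_iff, map_sub, proj_proj, sub_self]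

lemma disjoint_E_E' : Disjoint (E p q) (E' p q) := by
  rw [Submodule.disjoint_def]
  intro v h1 h2
  rw [← mem_E_iff.1 h1, mem_E'_iff.1 h2]

/-- A vector `v` of `U` has `π v` in `U` exactly when both its components lie in `U`, so `U ∩
π⁻¹(U)` is the direct sum of `U ∩ E` and `U ∩ E'`. This ties the two intersection dimensions to the
diagonal case `i = j` of the third family of conditions. -/
lemma finrank_map_proj_sup_self (U : Submodule ℂ (Fin (p + q) → ℂ)) :
    finrank ℂ ↥(U.map (proj p q) ⊔ U) + finrank ℂ ↥(U ⊓ E p q) + finrank ℂ ↥(U ⊓ E' p q) =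
      2 * finrank ℂ U := by
  have h1 := finrank_map_sup_add_finrank_inf_comap (proj p q) U U
  have h2 : U ⊓ U.comap (proj p q) = (U ⊓ E p q) ⊔ (U ⊓ E' p q) := by
    apply le_antisymm
    · rintro v ⟨h3, h4⟩
      rw [← add_sub_cancel (proj p q v) v]
      exact Submodule.add_mem_sup ⟨h4, proj_mem_E v⟩ ⟨U.sub_mem h3 h4, sub_proj_mem_E' v⟩
    · refine sup_le (fun v hv => ⟨hv.1, ?_⟩) (fun v hv => ⟨hv.1, ?_⟩)
      · rw [SetLike.mem_coe, Submodule.mem_comap, mem_E_iff.1 hv.2]; exact hv.1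
      · rw [SetLike.mem_coe, Submodule.mem_comap, mem_E'_iff.1 hv.2]; exact U.zero_mem
  have h3 := Submodule.finrank_sup_add_finrank_inf_eq (U ⊓ E p q) (U ⊓ E' p q)
  have h4 : (U ⊓ E p q) ⊓ (U ⊓ E' p q) = ⊥ := by
    rw [← disjoint_iff]
    exact disjoint_E_E'.mono inf_le_right inf_le_right
  rw [h4, finrank_bot] at h3
  rw [h2] at h1
  omega

end Projection

namespace CompleteFlag

variable {n : ℕ}

/-- The subspaces of a flag, indexed by natural numbers. -/
def level (F : CompleteFlag n) (i : ℕ) : Submodule ℂ (Fin n → ℂ) :=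
  F.space ⟨min i n, by omega⟩

lemma level_val (F : CompleteFlag n) (i : Fin (n + 1)) : F.level i = F.space i := by
  unfold level
  congr 1
  ext
  simp only
  omega

lemma level_mono (F : CompleteFlag n) {i j : ℕ} (h : i ≤ j) : F.level i ≤ F.level j :=
  F.mono (Fin.mk_le_mk.2 (min_le_min_right n h))

lemma finrank_level (F : CompleteFlag n) {i : ℕ} (h : i ≤ n) : finrank ℂ (F.level i) = i := by
  unfold level
  rw [F.finrank_space]
  simp only
  omega

lemma ext_level {F F' : CompleteFlag n} (h : ∀ i ≤ n, F.level i = F'.level i) : F = F' := by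
  ext1
  funext i
  rw [← level_val, ← level_val, h i (by omega)]

/-- The flags `F` and `F'` differ at most at the level `m + 1`. -/
def Adjacent (m : ℕ) (F F' : CompleteFlag n) : Prop :=
  ∀ i, i ≤ n → i ≠ m + 1 → F.level i = F'.level i

lemma Adjacent.symm {m : ℕ} {F F' : CompleteFlag n} (h : Adjacent m F F') : Adjacent m F' F :=
  fun i hi hi' => (h i hi hi').symm

lemma Adjacent.trans {m : ℕ} {F F' F'' : CompleteFlag n} (h : Adjacent m F F')
    (h' : Adjacent m F' F'') : Adjacent m F F'' :=
  fun i hi hi' => (h i hi hi').trans (h' i hi hi')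

lemma exists_adjacent (F : CompleteFlag n) {m : ℕ} (hm : m + 1 < n)
    (U : Submodule ℂ (Fin n → ℂ)) (h1 : F.level m ≤ U) (h2 : U ≤ F.level (m + 2))
    (h3 : finrank ℂ U = m + 1) : ∃ F' : CompleteFlag n, Adjacent m F F' ∧ F'.level (m + 1) = U := by
  let F' : CompleteFlag n :=
    { space := fun i => if (i : ℕ) = m + 1 then U else F.level i
      mono := fun i j hij => by
        have hij' : (i : ℕ) ≤ j := hij
        beta_reduce
        split_ifs with hi hj hj
        · exact le_rfl
        · exact h2.trans (F.level_mono (by omega))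
        · exact (F.level_mono (by omega)).trans h1
        · exact F.level_mono hij'
      finrank_space := fun i => by
        by_cases hi : (i : ℕ) = m + 1
        · rw [if_pos hi, h3, hi]
        · rw [if_neg hi]; exact F.finrank_level (by omega) }
  have hF' : ∀ i ≤ n, F'.level i = if i = m + 1 then U else F.level i := by
    intro i hi
    exact F'.level_val ⟨i, by omega⟩
  refine ⟨F', fun i hi hi' => ?_, ?_⟩
  · rw [hF' i hi, if_neg hi']
  · rw [hF' _ (by omega), if_pos rfl]

end CompleteFlag

section RankConditions

variable {p q : ℕ}

/-- The flags satisfying the rank inequalities of a clan. -/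
def rankLocus (γ : Clan p q) : Set (CompleteFlag (p + q)) :=
  {F | (∀ i : Fin (p + q + 1), γ.rankPlus i ≤ finrank ℂ ↥(F.space i ⊓ E p q)) ∧
    (∀ i : Fin (p + q + 1), γ.rankMinus i ≤ finrank ℂ ↥(F.space i ⊓ E' p q)) ∧
    ∀ i j : Fin (p + q + 1), i < j →
      finrank ℂ ↥((F.space i).map (proj p q) ⊔ F.space j) ≤ (j : ℕ) + γ.rankCross i j}

lemma mem_rankLocus_iff {γ : Clan p q} {F : CompleteFlag (p + q)} : F ∈ rankLocus γ ↔
    (∀ i ≤ p + q, γ.rankPlus i ≤ finrank ℂ ↥(F.level i ⊓ E p q)) ∧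
    (∀ i ≤ p + q, γ.rankMinus i ≤ finrank ℂ ↥(F.level i ⊓ E' p q)) ∧
    ∀ i j, i < j → j ≤ p + q →
      finrank ℂ ↥((F.level i).map (proj p q) ⊔ F.level j) ≤ j + γ.rankCross i j := by
  constructor
  · rintro ⟨h1, h2, h3⟩
    refine ⟨fun i hi => ?_, fun i hi => ?_, fun i j hij hj => ?_⟩
    · have := h1 ⟨i, by omega⟩; rwa [← CompleteFlag.level_val] at this
    · have := h2 ⟨i, by omega⟩; rwa [← CompleteFlag.level_val] at this
    · have := h3 ⟨i, by omega⟩ ⟨j, by omega⟩ (Fin.mk_lt_mk.2 hij)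
      rwa [← CompleteFlag.level_val, ← CompleteFlag.level_val] at this
  · rintro ⟨h1, h2, h3⟩
    refine ⟨fun i => ?_, fun i => ?_, fun i j hij => ?_⟩
    · rw [← CompleteFlag.level_val]; exact h1 i (by omega)
    · rw [← CompleteFlag.level_val]; exact h2 i (by omega)
    · rw [← CompleteFlag.level_val, ← CompleteFlag.level_val]; exact h3 i j hij (by omega)

lemma mem_Q_iff {γ : Clan p q} {F : CompleteFlag (p + q)} : F ∈ Q γ ↔
    (∀ i ≤ p + q, finrank ℂ ↥(F.level i ⊓ E p q) = γ.rankPlus i) ∧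
    (∀ i ≤ p + q, finrank ℂ ↥(F.level i ⊓ E' p q) = γ.rankMinus i) ∧
    ∀ i j, i < j → j ≤ p + q →
      finrank ℂ ↥((F.level i).map (proj p q) ⊔ F.level j) = j + γ.rankCross i j := by
  constructor
  · rintro ⟨h1, h2, h3⟩
    refine ⟨fun i hi => ?_, fun i hi => ?_, fun i j hij hj => ?_⟩
    · have := h1 ⟨i, by omega⟩; rwa [← CompleteFlag.level_val] at this
    · have := h2 ⟨i, by omega⟩; rwa [← CompleteFlag.level_val] at this
    · have := h3 ⟨i, by omega⟩ ⟨j, by omega⟩ (Fin.mk_lt_mk.2 hij)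
      rwa [← CompleteFlag.level_val, ← CompleteFlag.level_val] at this
  · rintro ⟨h1, h2, h3⟩
    refine ⟨fun i => ?_, fun i => ?_, fun i j hij => ?_⟩
    · rw [← CompleteFlag.level_val]; exact h1 i (by omega)
    · rw [← CompleteFlag.level_val]; exact h2 i (by omega)
    · rw [← CompleteFlag.level_val, ← CompleteFlag.level_val]; exact h3 i j hij (by omega)

lemma Q_subset_rankLocus (γ : Clan p q) : Q γ ⊆ rankLocus γ :=
  fun _ h => ⟨fun i => (h.1 i).ge, fun i => (h.2.1 i).ge, fun i j hij => (h.2.2 i j hij).le⟩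

lemma finrank_map_proj_sup_level_self (F : CompleteFlag (p + q)) {i : ℕ} (hi : i ≤ p + q) :
    finrank ℂ ↥((F.level i).map (proj p q) ⊔ F.level i) + finrank ℂ ↥(F.level i ⊓ E p q) +
      finrank ℂ ↥(F.level i ⊓ E' p q) = 2 * i := by
  rw [finrank_map_proj_sup_self, F.finrank_level hi]

/-- The diagonal case, absent from the definition, is the sum of the two intersection inequalities,
since `γ(i;+) + γ(i;-) + γ(i;i) = i`. -/
lemma finrank_cross_le {γ : Clan p q} {F : CompleteFlag (p + q)} (hF : F ∈ rankLocus γ) {i j : ℕ}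
    (hij : i ≤ j) (hj : j ≤ p + q) :
    finrank ℂ ↥((F.level i).map (proj p q) ⊔ F.level j) ≤ j + γ.rankCross i j := by
  obtain ⟨h1, h2, h3⟩ := mem_rankLocus_iff.1 hF
  rcases hij.lt_or_eq with h | rfl
  · exact h3 i j h hj
  · have := finrank_map_proj_sup_level_self F hj
    have := γ.rankPlus_add_rankMinus_add_rankCross hj
    have := h1 i hj
    have := h2 i hj
    omega

/-- A flag satisfying the inequalities of `γ` and the opposite inequalities for the spaces
`π(F_i) + F_j` satisfies all equalities. -/
lemma mem_Q_of_le_finrank_cross {γ : Clan p q} {F : CompleteFlag (p + q)} (hF : F ∈ rankLocus γ)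
    (h : ∀ i j, i ≤ j → j ≤ p + q →
      j + γ.rankCross i j ≤ finrank ℂ ↥((F.level i).map (proj p q) ⊔ F.level j)) : F ∈ Q γ := by
  obtain ⟨h1, h2, h3⟩ := mem_rankLocus_iff.1 hF
  rw [mem_Q_iff]
  refine ⟨fun i hi => ?_, fun i hi => ?_, fun i j hij hj =>
    le_antisymm (h3 i j hij hj) (h i j hij.le hj)⟩
  all_goals
    have := finrank_map_proj_sup_level_self F hi
    have := γ.rankPlus_add_rankMinus_add_rankCross hi
    have := h1 i hi
    have := h2 i hi
    have := h i i le_rfl hi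
    omega

lemma finrank_cross_eq {γ : Clan p q} {F : CompleteFlag (p + q)} (hF : F ∈ Q γ) {i j : ℕ}
    (hij : i ≤ j) (hj : j ≤ p + q) :
    finrank ℂ ↥((F.level i).map (proj p q) ⊔ F.level j) = j + γ.rankCross i j := by
  obtain ⟨h1, h2, h3⟩ := mem_Q_iff.1 hF
  rcases hij.lt_or_eq with h | rfl
  · exact h3 i j h hj
  · have := finrank_map_proj_sup_level_self F hj
    have := γ.rankPlus_add_rankMinus_add_rankCross hj
    have := h1 i hj
    have := h2 i hj
    omega

end RankConditions

end

/-! ### Moving one level of a flag: from the inequalities of a clan to those of a descent. -/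

section

variable {p q : ℕ}

/-- Away from level `m + 1` neither the flag nor the rank numbers change, so only four families of
inequalities remain to be checked. -/
lemma mem_rankLocus_of_adjacent {γ γ' : Clan p q} {m : ℕ} (h : Clan.IsDescent m γ' γ)
    {F F' : CompleteFlag (p + q)} (hF : F ∈ rankLocus γ) (hadj : CompleteFlag.Adjacent m F F')
    (hP : γ'.rankPlus (m + 1) ≤ finrank ℂ ↥(F'.level (m + 1) ⊓ E p q))
    (hM : γ'.rankMinus (m + 1) ≤ finrank ℂ ↥(F'.level (m + 1) ⊓ E' p q))
    (hK : ∀ k ≤ m, finrank ℂ ↥((F.level k).map (proj p q) ⊔ F'.level (m + 1)) ≤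
      m + 1 + γ'.rankCross k (m + 1))
    (hL : ∀ l, m + 2 ≤ l → l ≤ p + q →
      finrank ℂ ↥((F'.level (m + 1)).map (proj p q) ⊔ F.level l) ≤ l + γ'.rankCross (m + 1) l) :
    F' ∈ rankLocus γ' := by
  obtain ⟨h1, h2, h3⟩ := mem_rankLocus_iff.1 hF
  have hm := h.lt
  rw [mem_rankLocus_iff]
  refine ⟨fun i hi => ?_, fun i hi => ?_, fun i j hij hj => ?_⟩
  · by_cases e : i = m + 1
    · rw [e]; exact hP
    · rw [h.rankPlus i e, ← hadj i hi e]; exact h1 i hi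
  · by_cases e : i = m + 1
    · rw [e]; exact hM
    · rw [h.rankMinus i e, ← hadj i hi e]; exact h2 i hi
  · by_cases ei : i = m + 1
    · rw [ei, ← hadj j hj (by omega)]
      exact hL j (by omega) hj
    · by_cases ej : j = m + 1
      · rw [ej, ← hadj i (by omega) ei]
        exact hK i (by omega)
      · rw [h.rankCross_of_ne hij.le ei ej, ← hadj i (by omega) ei, ← hadj j hj ej]
        exact h3 i j hij hj

/-- A direction `y` along which the level `m + 1` of a flag satisfying the inequalities of `γ` can be
moved so that it satisfies the inequalities of a descent `γ'`. -/
lemma exists_direction {γ γ' : Clan p q} {m : ℕ} (h : Clan.IsDescent m γ' γ)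
    {F : CompleteFlag (p + q)} (hF : F ∈ rankLocus γ) :
    ∃ y ∈ F.level (m + 2), y ∉ F.level m ∧
      γ'.rankPlus (m + 1) ≤ finrank ℂ ↥((F.level m ⊔ ℂ ∙ y) ⊓ E p q) ∧
      γ'.rankMinus (m + 1) ≤ finrank ℂ ↥((F.level m ⊔ ℂ ∙ y) ⊓ E' p q) ∧
      (∀ k ≤ m, finrank ℂ ↥((F.level k).map (proj p q) ⊔ (F.level m ⊔ ℂ ∙ y)) ≤
        m + 1 + γ'.rankCross k (m + 1)) ∧
      ∀ l, m + 2 ≤ l → l ≤ p + q →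
        finrank ℂ ↥((F.level m ⊔ ℂ ∙ y).map (proj p q) ⊔ F.level l) ≤
          l + γ'.rankCross (m + 1) l := by
  obtain ⟨hP, hM, -⟩ := mem_rankLocus_iff.1 hF
  have hm := h.lt
  have hAC : F.level m ≤ F.level (m + 2) := F.level_mono (by omega)
  have dA := F.finrank_level (i := m) (by omega)
  have dC := F.finrank_level (i := m + 2) (by omega)
  have hyU : ∀ y, y ∈ F.level m ⊔ ℂ ∙ y := fun y =>
    Submodule.mem_sup_right (Submodule.mem_span_singleton_self y)
  have P1 := hP m (by omega)
  have P2 := hP (m + 2) (by omega)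
  have M1 := hM m (by omega)
  have M2 := hM (m + 2) (by omega)
  rw [← h.rankPlus m (by omega)] at P1
  rw [← h.rankPlus (m + 2) (by omega)] at P2
  rw [← h.rankMinus m (by omega)] at M1
  rw [← h.rankMinus (m + 2) (by omega)] at M2
  have P3 := γ'.rankPlus_succ_le m
  have M3 := γ'.rankMinus_succ_le m
  have P4 := γ'.rankPlus_mono (i := m + 1) (j := m + 2) (by omega)
  have M4 := γ'.rankMinus_mono (i := m + 1) (j := m + 2) (by omega)
  have hgrow : ∀ (S : Submodule ℂ (Fin (p + q) → ℂ)) (y z : Fin (p + q) → ℂ),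
      z ∈ F.level m ⊔ ℂ ∙ y → z ∉ F.level m → z ∈ S →
      finrank ℂ ↥(F.level m ⊓ S) < finrank ℂ ↥((F.level m ⊔ ℂ ∙ y) ⊓ S) := fun S y z h1 h2 h3 =>
    finrank_lt_finrank_of_mem (inf_le_inf_right _ le_sup_left) ⟨h1, h3⟩ fun h4 => h2 h4.1
  have hkeep : ∀ (S : Submodule ℂ (Fin (p + q) → ℂ)) (y : Fin (p + q) → ℂ),
      finrank ℂ ↥(F.level m ⊓ S) ≤ finrank ℂ ↥((F.level m ⊔ ℂ ∙ y) ⊓ S) := fun S y =>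
    Submodule.finrank_mono (inf_le_inf_right _ le_sup_left)
  have hK1 : ∀ k y, finrank ℂ ↥((F.level k).map (proj p q) ⊔ F.level m) ≤
      m + γ'.rankCross k (m + 1) →
      finrank ℂ ↥((F.level k).map (proj p q) ⊔ (F.level m ⊔ ℂ ∙ y)) ≤
        m + 1 + γ'.rankCross k (m + 1) := by
    intro k y h1
    rw [← sup_assoc]
    have := finrank_sup_span_singleton_le ((F.level k).map (proj p q) ⊔ F.level m) y
    omega
  have hK2 : ∀ k ≤ m, ∀ y ∈ (F.level k).map (proj p q) ⊔ F.level m,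
      finrank ℂ ↥((F.level k).map (proj p q) ⊔ (F.level m ⊔ ℂ ∙ y)) ≤
        m + 1 + γ'.rankCross k (m + 1) := by
    intro k hk y h1
    rw [← sup_assoc, sup_eq_left.2 ((Submodule.span_singleton_le_iff_mem _ _).2 h1)]
    have h2 := finrank_cross_le hF hk (by omega)
    have h3 := γ'.rankCross_le_right_succ k m
    rw [h.rankCross_of_ne hk (by omega) (by omega)] at h3
    omega
  have hmapU : ∀ l y, (F.level m ⊔ ℂ ∙ y).map (proj p q) ⊔ F.level l =
      ((F.level m).map (proj p q) ⊔ F.level l) ⊔ ℂ ∙ (proj p q y) := by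
    intro l y
    rw [Submodule.map_sup, Submodule.map_span, Set.image_singleton, sup_right_comm]
  have hL1 : ∀ l y, m + 2 ≤ l → l ≤ p + q →
      finrank ℂ ↥((F.level m).map (proj p q) ⊔ F.level l) < l + γ.rankCross m l →
      finrank ℂ ↥((F.level m ⊔ ℂ ∙ y).map (proj p q) ⊔ F.level l) ≤
          l + γ'.rankCross (m + 1) l := by
    intro l y hl hl' h1
    rw [hmapU, h.rankCross_left hl]
    exact (finrank_sup_span_singleton_le _ _).trans h1
  have hL2 : ∀ l y, m + 2 ≤ l → l ≤ p + q →
      proj p q y ∈ (F.level m).map (proj p q) ⊔ F.level l →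
      finrank ℂ ↥((F.level m ⊔ ℂ ∙ y).map (proj p q) ⊔ F.level l) ≤
          l + γ'.rankCross (m + 1) l := by
    intro l y hl hl' h1
    rw [hmapU, h.rankCross_left hl, sup_eq_left.2 ((Submodule.span_singleton_le_iff_mem _ _).2 h1)]
    exact finrank_cross_le hF (by omega) hl'
  have hL3 : ∀ y, proj p q y ∈ F.level (m + 2) → ∀ l, m + 2 ≤ l → l ≤ p + q →
      finrank ℂ ↥((F.level m ⊔ ℂ ∙ y).map (proj p q) ⊔ F.level l) ≤
          l + γ'.rankCross (m + 1) l := fun y hy l hl hl' =>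
    hL2 l y hl hl' (Submodule.mem_sup_right (F.level_mono hl hy))
  classical
  -- The choice of `y` is dictated by the first obstruction met. Where `π(F_k) + F_m` is already
  -- small enough, adding any `y` is harmless (`hK1`); otherwise `y` must lie in that sum (`hK2`).
  -- Taking the least bad `k` serves all larger indices by monotonicity.
  by_cases hk : ∃ k, k ≤ m ∧ m + γ'.rankCross k (m + 1) <
      finrank ℂ ↥((F.level k).map (proj p q) ⊔ F.level m)
  · obtain ⟨hk1, hk2⟩ := Nat.find_spec hk
    have hmin : ∀ j < Nat.find hk, ¬ (j ≤ m ∧ m + γ'.rankCross j (m + 1) <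
      finrank ℂ ↥((F.level j).map (proj p q) ⊔ F.level m)) := fun j hj => Nat.find_min hk hj
    generalize Nat.find hk = k at hk1 hk2 hmin
    have h1 := finrank_map_sup_add_finrank_inf_comap LinearMap.id (F.level (m + 2))
      ((F.level k).map (proj p q) ⊔ F.level m)
    rw [Submodule.map_id, Submodule.comap_id] at h1
    have h2 := finrank_cross_le hF (i := k) (j := m + 2) (by omega) (by omega)
    have h3 : F.level (m + 2) ⊔ ((F.level k).map (proj p q) ⊔ F.level m) =
        (F.level k).map (proj p q) ⊔ F.level (m + 2) := by
      rw [sup_left_comm, sup_eq_left.2 hAC]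
    rw [h3, dC] at h1
    rw [← h.rankCross_right hk1] at h2
    -- The bound on `π(F_k) + F_{m+2}` forces this intersection to have dimension greater than `m`.
    -- Modulo `F_m` the new vector can be taken of the form `π f` with `f ∈ F_k`; then `π f ∈ E` and
    -- `f - π f ∈ E'` are both new, so both intersections grow.
    obtain ⟨z, ⟨hz1, hz2⟩, hz3⟩ := exists_mem_notMem_of_finrank_lt (S := F.level m)
      (T := F.level (m + 2) ⊓ ((F.level k).map (proj p q) ⊔ F.level m)) (by omega)
    obtain ⟨_, ⟨f, hf, rfl⟩, a, ha, rfl⟩ := Submodule.mem_sup.1 hz2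
    have hfm : f ∈ F.level m := F.level_mono hk1 hf
    have hy1 : proj p q f ∈ F.level (m + 2) := by
      have := Submodule.sub_mem _ hz1 (hAC ha)
      rwa [add_sub_cancel_right] at this
    have hy2 : proj p q f ∉ F.level m := fun h4 => hz3 (Submodule.add_mem _ h4 ha)
    have hy3 : f - proj p q f ∉ F.level m := fun h4 => hy2 (by
      have := Submodule.sub_mem _ hfm h4
      rwa [sub_sub_cancel] at this)
    refine ⟨proj p q f, hy1, hy2, ?_, ?_, fun j hj => ?_, hL3 _ ?_⟩
    · have := hgrow (E p q) _ _ (hyU (proj p q f)) hy2 (proj_mem_E f)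
      omega
    · have := hgrow (E' p q) (proj p q f) _ (Submodule.sub_mem _ (Submodule.mem_sup_left hfm)
        (hyU _)) hy3 (sub_proj_mem_E' f)
      omega
    · by_cases hjk : j < k
      · exact hK1 _ _ (not_lt.1 fun h4 => hmin j hjk ⟨hj, h4⟩)
      · exact hK2 j hj _ (Submodule.mem_sup_left
          (Submodule.mem_map_of_mem (F.level_mono (not_lt.1 hjk) hf)))
    · rwa [proj_proj]
  push Not at hk
  have hK3 : ∀ y, ∀ k ≤ m, finrank ℂ ↥((F.level k).map (proj p q) ⊔ (F.level m ⊔ ℂ ∙ y)) ≤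
      m + 1 + γ'.rankCross k (m + 1) := fun y k hk' => hK1 k y (hk k hk')
  -- The conditions on `π(F_k)` now hold for every `y`. If `F_m ∩ E` is too small, `y` must be taken
  -- in `E`.
  by_cases hp : finrank ℂ ↥(F.level m ⊓ E p q) < γ'.rankPlus (m + 1)
  · obtain ⟨y, ⟨hy1, hy2⟩, hy3⟩ := exists_mem_notMem_of_finrank_lt
      (S := F.level m ⊓ E p q) (T := F.level (m + 2) ⊓ E p q) (by omega)
    have hy4 : y ∉ F.level m := fun h4 => hy3 ⟨h4, hy2⟩
    refine ⟨y, hy1, hy4, ?_, ?_, hK3 y, hL3 y ?_⟩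
    · have := hgrow (E p q) _ _ (hyU y) hy4 hy2
      omega
    -- The bound at `k = m` says that the two intersections with `F_m` together miss the target for
    -- `γ'` at `m + 1` by at most one. The deficit is on the `E` side, so the `E'` side already
    -- suffices.
    · have h1 := hk m le_rfl
      have h2 := finrank_map_proj_sup_level_self F (i := m) (by omega)
      have h3 := γ'.rankPlus_add_rankMinus_add_rankCross (i := m + 1) (by omega)
      have h4 := h.rankCross_right (le_refl m)
      have h5 := h.rankCross_self
      have := hkeep (E' p q) y
      omega
    · rwa [mem_E_iff.1 hy2]
  have hP' := fun y => (not_lt.1 hp).trans (hkeep (E p q) y)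
  by_cases hq : finrank ℂ ↥(F.level m ⊓ E' p q) < γ'.rankMinus (m + 1)
  · obtain ⟨y, ⟨hy1, hy2⟩, hy3⟩ := exists_mem_notMem_of_finrank_lt
      (S := F.level m ⊓ E' p q) (T := F.level (m + 2) ⊓ E' p q) (by omega)
    have hy4 : y ∉ F.level m := fun h4 => hy3 ⟨h4, hy2⟩
    refine ⟨y, hy1, hy4, hP' y, ?_, hK3 y, hL3 y ?_⟩
    · have := hgrow (E' p q) _ _ (hyU y) hy4 hy2
      omega
    · rw [mem_E'_iff.1 hy2]; exact Submodule.zero_mem _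
  have hM' := fun y => (not_lt.1 hq).trans (hkeep (E' p q) y)
  -- Only the sums `π(F_m + ℂy) + F_l` remain. Where the bound for `π(F_m) + F_l` has slack, any `y`
  -- works; the least `l` without slack determines a condition on `π y` that persists for larger
  -- `l`.
  by_cases hl : ∃ l, m + 2 ≤ l ∧ l ≤ p + q ∧ l + γ.rankCross m l ≤
      finrank ℂ ↥((F.level m).map (proj p q) ⊔ F.level l)
  · obtain ⟨hl1, hl2, hl3⟩ := Nat.find_spec hl
    have hmin : ∀ j < Nat.find hl, ¬ (m + 2 ≤ j ∧ j ≤ p + q ∧ j + γ.rankCross m j ≤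
      finrank ℂ ↥((F.level m).map (proj p q) ⊔ F.level j)) := fun j hj => Nat.find_min hl hj
    generalize Nat.find hl = l at hl1 hl2 hl3 hmin
    have h1 := finrank_map_sup_add_finrank_inf_comap (proj p q) (F.level (m + 2))
      ((F.level m).map (proj p q) ⊔ F.level l)
    have h2 := finrank_cross_le hF hl1 hl2
    have h3 : (F.level (m + 2)).map (proj p q) ⊔ ((F.level m).map (proj p q) ⊔ F.level l) =
        (F.level (m + 2)).map (proj p q) ⊔ F.level l := by
      rw [← sup_assoc]
      congr 1
      exact sup_eq_left.2 (Submodule.map_mono hAC)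
    have h4 := γ'.rankCross_le_left_succ (m + 1) l
    rw [h.rankCross_left hl1, h.rankCross_of_ne (i := m + 2) hl1 (by omega) (by omega)] at h4
    rw [h3, dC] at h1
    -- Passing from `π(F_m) + F_l` to `π(F_{m+2}) + F_l` gains at most one dimension, so the
    -- condition on `π y` cuts out a subspace of dimension at least `m + 1` in `F_{m+2}`.
    obtain ⟨y, ⟨hy1, hy2⟩, hy3⟩ := exists_mem_notMem_of_finrank_lt (S := F.level m)
      (T := F.level (m + 2) ⊓ ((F.level m).map (proj p q) ⊔ F.level l).comap (proj p q)) (by omega)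
    refine ⟨y, hy1, hy3, hP' y, hM' y, hK3 y, fun j hj hj' => ?_⟩
    by_cases hjl : j < l
    · exact hL1 j y hj hj' (not_le.1 fun h5 => hmin j hjl ⟨hj, hj', h5⟩)
    · exact hL2 j y hj hj' (sup_le_sup_left (F.level_mono (not_lt.1 hjl)) _ hy2)
  push Not at hl
  obtain ⟨y, hy1, hy2⟩ := exists_mem_notMem_of_finrank_lt (S := F.level m)
    (T := F.level (m + 2)) (by omega)
  exact ⟨y, hy1, hy2, hP' y, hM' y, hK3 y, fun j hj hj' => hL1 j y hj hj' (hl j hj hj')⟩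

/-- Every flag satisfying the inequalities of `γ` is adjacent to one satisfying those of a descent. -/
lemma exists_adjacent_mem_rankLocus {γ γ' : Clan p q} {m : ℕ} (h : Clan.IsDescent m γ' γ)
    {F : CompleteFlag (p + q)} (hF : F ∈ rankLocus γ) :
    ∃ F' ∈ rankLocus γ', CompleteFlag.Adjacent m F F' := by
  obtain ⟨y, hy, hy', h1, h2, h3, h4⟩ := exists_direction h hF
  have hm := h.lt
  obtain ⟨F', hadj, hF'⟩ := F.exists_adjacent h.lt (F.level m ⊔ ℂ ∙ y) le_sup_left
    (sup_le (F.level_mono (by omega)) ((Submodule.span_singleton_le_iff_mem _ _).2 hy))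
    (by rw [Submodule.finrank_sup_span_singleton hy', F.finrank_level (by omega)])
  refine ⟨F', mem_rankLocus_of_adjacent h hF hadj ?_ ?_ ?_ ?_, hadj⟩ <;> rwa [hF']

/-- The upper bounds are those of `rankLocus γ'`. Lower bounds come from `F`: shrinking `F_{m+2}` to
`F'_{m+1}` loses at most one dimension, and `π(F'_{m+1})` contains `π(F_m)`. Both match the shifted
cross ranks of a descent exactly. -/
lemma mem_Q_of_adjacent {γ γ' : Clan p q} {m : ℕ} (h : Clan.IsDescent m γ' γ)
    {F F' : CompleteFlag (p + q)} (hF : F ∈ Q γ) (hadj : CompleteFlag.Adjacent m F F')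
    (hF' : F' ∈ rankLocus γ') : F' ∈ Q γ' := by
  have hm := h.lt
  have hA : F.level m = F'.level m := hadj m (by omega) (by omega)
  have hC : F.level (m + 2) = F'.level (m + 2) := hadj (m + 2) (by omega) (by omega)
  have key : ∀ k ≤ m, m + 1 + γ.rankCross k (m + 2) ≤
      finrank ℂ ↥((F.level k).map (proj p q) ⊔ F'.level (m + 1)) := by
    intro k hk
    have h1 := finrank_cross_eq hF (i := k) (j := m + 2) (by omega) (by omega)
    have d1 := F'.finrank_level (i := m + 1) (by omega)
    have d2 := F'.finrank_level (i := m + 2) (by omega)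
    obtain ⟨y, hy, hy'⟩ := exists_mem_notMem_of_finrank_lt (S := F'.level (m + 1))
      (T := F'.level (m + 2)) (by omega)
    rw [hC, ← sup_span_singleton_eq_of_finrank (F'.level_mono (by omega)) hy hy' (by omega),
      ← sup_assoc] at h1
    have := finrank_sup_span_singleton_le ((F.level k).map (proj p q) ⊔ F'.level (m + 1)) y
    omega
  refine mem_Q_of_le_finrank_cross hF' fun i j hij hj => ?_
  by_cases ei : i = m + 1
  · subst ei
    have hle : (F.level m).map (proj p q) ≤ (F'.level (m + 1)).map (proj p q) := by
      rw [hA]; exact Submodule.map_mono (F'.level_mono (by omega))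
    by_cases ej : j = m + 1
    · subst ej
      rw [h.rankCross_self]
      exact (key m le_rfl).trans (Submodule.finrank_mono (sup_le_sup_right hle _))
    · rw [h.rankCross_left (by omega), ← finrank_cross_eq hF (by omega) hj, hadj j hj ej]
      exact Submodule.finrank_mono (sup_le_sup_right hle _)
  · rw [← hadj i (by omega) ei]
    by_cases ej : j = m + 1
    · subst ej
      rw [h.rankCross_right (by omega)]
      exact key i (by omega)
    · rw [h.rankCross_of_ne hij ei ej, ← hadj j hj ej, finrank_cross_eq hF hij hj]

end

/-! ### Adapted bases and their transport to an adjacent flag. -/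

section

namespace CompleteFlag

variable {n : ℕ} {F : CompleteFlag n} {v : Fin n → Fin n → ℂ}

lemma level_eq_span (h : ∀ k : Fin n, v k ∈ F.level (k + 1)) (h' : ∀ k : Fin n, v k ∉ F.level k)
    {i : ℕ} (hi : i ≤ n) : F.level i = Submodule.span ℂ (v '' {k | (k : ℕ) < i}) := by
  induction i with
  | zero =>
    have h1 : F.level 0 = ⊥ := Submodule.finrank_eq_zero.1 (F.finrank_level (Nat.zero_le _))
    simp [h1]
  | succ i ih =>
    have h1 := sup_span_singleton_eq_of_finrank (F.level_mono (Nat.le_succ i)) (h ⟨i, hi⟩)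
      (h' ⟨i, hi⟩) (by rw [F.finrank_level hi, F.finrank_level (by omega)])
    rw [← h1, ih (by omega), ← Submodule.span_union]
    congr 1
    rw [← Set.image_singleton, ← Set.image_union]
    congr 1
    ext k
    simp only [Set.mem_union, Set.mem_ofPred_eq, Set.mem_singleton_iff, Fin.ext_iff]
    omega

lemma level_top (F : CompleteFlag n) : F.level n = ⊤ :=
  Submodule.eq_top_of_finrank_eq (by rw [F.finrank_level le_rfl]; simp)

lemma linearIndependent_of_mem_level (h : ∀ k : Fin n, v k ∈ F.level (k + 1))
    (h' : ∀ k : Fin n, v k ∉ F.level k) : LinearIndependent ℂ v := by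
  refine linearIndependent_of_top_le_span_of_card_eq_finrank ?_ (by simp)
  rw [← F.level_top, level_eq_span h h' le_rfl]
  exact Submodule.span_mono (Set.image_subset_range _ _)

/-- A vector of `F_{m+2}` can be moved into `F_{m+1}` along a given direction outside of `F_{m+1}`. -/
lemma exists_sub_smul_mem (F : CompleteFlag n) {m : ℕ} (hm : m + 1 < n) {x y : Fin n → ℂ}
    (hx : x ∈ F.level (m + 2)) (hy : y ∈ F.level (m + 2)) (hy' : y ∉ F.level (m + 1)) :
    ∃ t : ℂ, x - t • y ∈ F.level (m + 1) := by
  rw [← sup_span_singleton_eq_of_finrank (F.level_mono (by omega)) hy hy'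
    (by rw [F.finrank_level (by omega), F.finrank_level (by omega)])] at hx
  obtain ⟨a, ha, b, hb, rfl⟩ := Submodule.mem_sup.1 hx
  obtain ⟨t, rfl⟩ := Submodule.mem_span_singleton.1 hb
  exact ⟨t, by rwa [add_sub_cancel_right]⟩

end CompleteFlag

lemma finrank_span_image_finset {𝕜 V ι : Type*} [Field 𝕜] [AddCommGroup V] [Module 𝕜 V]
    {v : ι → V} (hv : LinearIndependent 𝕜 v) (s : Finset ι) :
    finrank 𝕜 (Submodule.span 𝕜 (v '' s)) = s.card := by
  have h := finrank_span_eq_card (hv.comp (Subtype.val : s → ι) Subtype.val_injective)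
  rw [Set.range_comp, Subtype.range_coe_subtype] at h
  simpa using h

variable {p q : ℕ}

/-- A basis adapted to a flag, on which the projection acts as prescribed by the clan. -/
structure IsAdaptedBasis (γ : Clan p q) (F : CompleteFlag (p + q))
    (v : Fin (p + q) → Fin (p + q) → ℂ) : Prop where
  mem : ∀ k : Fin (p + q), v k ∈ F.level (k + 1)
  notMem : ∀ k : Fin (p + q), v k ∉ F.level k
  plusOrClosing : ∀ k, γ.PlusOrClosing k → proj p q (v k) = v k
  minus : ∀ k ∈ γ.minus, proj p q (v k) = 0
  opening : ∀ k, k < γ.inv k → proj p q (v k) = v (γ.inv k)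

/-- The flags having a basis adapted to a clan. -/
def adaptedFlags (γ : Clan p q) : Set (CompleteFlag (p + q)) := {F | ∃ v, IsAdaptedBasis γ F v}

lemma Clan.rankCross_eq (γ : Clan p q) (i j : ℕ) : γ.rankCross i j =
    (Finset.univ.filter fun k : Fin (p + q) => (γ.inv k : ℕ) < i ∧ j ≤ (k : ℕ)).card := by
  unfold Clan.rankCross
  refine Finset.card_equiv γ.inv fun x => ?_
  simp only [Finset.mem_filter, Finset.mem_univ, true_and, γ.inv_inv]

/-- The projection sends each basis vector to zero or to a basis vector; beyond level `i` it reaches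
exactly the mates of the positions still open at `i`. -/
lemma IsAdaptedBasis.map_level {γ : Clan p q} {F : CompleteFlag (p + q)}
    {v : Fin (p + q) → Fin (p + q) → ℂ} (h : IsAdaptedBasis γ F v) {i : ℕ} (hi : i ≤ p + q) :
    (F.level i).map (proj p q) = Submodule.span ℂ (v ''
      {k | ((k : ℕ) < i ∧ γ.PlusOrClosing k) ∨ ((γ.inv k : ℕ) < i ∧ i ≤ (k : ℕ))}) := by
  rw [CompleteFlag.level_eq_span h.mem h.notMem hi, Submodule.map_span]
  apply le_antisymm
  · rw [Submodule.span_le]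
    rintro _ ⟨_, ⟨k, hk, rfl⟩, rfl⟩
    have hk' : (k : ℕ) < i := hk
    have hfix := γ.fixed_iff k
    rcases lt_trichotomy (γ.inv k) k with h1 | h1 | h1
    · rw [h.plusOrClosing k (Or.inr h1)]
      exact Submodule.subset_span ⟨k, Or.inl ⟨hk', Or.inr h1⟩, rfl⟩
    · rcases hfix.1 h1 with h2 | h2
      · rw [h.plusOrClosing k (Or.inl h2)]
        exact Submodule.subset_span ⟨k, Or.inl ⟨hk', Or.inl h2⟩, rfl⟩
      · rw [h.minus k h2]
        exact Submodule.zero_mem _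
    · rw [h.opening k h1]
      refine Submodule.subset_span ⟨γ.inv k, ?_, rfl⟩
      by_cases h2 : (γ.inv k : ℕ) < i
      · left
        exact ⟨h2, Or.inr (by rwa [γ.inv_inv])⟩
      · right
        rw [γ.inv_inv]
        exact ⟨hk', by omega⟩
  · rw [Submodule.span_le]
    rintro _ ⟨k, (⟨h1, h2⟩ | ⟨h1, h2⟩), rfl⟩
    · exact Submodule.subset_span ⟨v k, ⟨k, h1, rfl⟩, h.plusOrClosing k h2⟩
    · refine Submodule.subset_span ⟨v (γ.inv k), ⟨γ.inv k, h1, rfl⟩, ?_⟩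
      rw [h.opening _ (by rw [γ.inv_inv, Fin.lt_def]; omega), γ.inv_inv]

/-- The levels and their images are spanned by subsets of one basis, so their dimensions and those
of the sums are counts of positions. The intersection with `E'` follows by rank-nullity and that
with `E` from the diagonal identity. -/
lemma adaptedFlags_subset_Q (γ : Clan p q) : adaptedFlags γ ⊆ Q γ := by
  rintro F ⟨v, h⟩
  have hli := CompleteFlag.linearIndependent_of_mem_level h.mem h.notMem
  have hcross : ∀ i j, i ≤ j → j ≤ p + q →
      finrank ℂ ↥((F.level i).map (proj p q) ⊔ F.level j) = j + γ.rankCross i j := by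
    intro i j hij hj
    rw [h.map_level (by omega), CompleteFlag.level_eq_span h.mem h.notMem hj,
      ← Submodule.span_union, ← Set.image_union, γ.rankCross_eq]
    have h1 : {k : Fin (p + q) | ((k : ℕ) < i ∧ γ.PlusOrClosing k) ∨
        ((γ.inv k : ℕ) < i ∧ i ≤ (k : ℕ))} ∪ {k | (k : ℕ) < j} =
        ((Finset.univ.filter fun k : Fin (p + q) => (k : ℕ) < j) ∪
          Finset.univ.filter fun k : Fin (p + q) => (γ.inv k : ℕ) < i ∧ j ≤ (k : ℕ) : Finset _) := by
      ext k
      simp only [Set.mem_union, Set.mem_ofPred_eq, Finset.coe_union, Finset.coe_filter,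
        Finset.mem_univ, true_and]
      constructor
      · rintro ((h1 | h1) | h1)
        · left; omega
        · by_cases h2 : (k : ℕ) < j
          · exact Or.inl h2
          · exact Or.inr ⟨h1.1, by omega⟩
        · exact Or.inl h1
      · rintro (h1 | h1)
        · exact Or.inr h1
        · exact Or.inl (Or.inr ⟨h1.1, by omega⟩)
    rw [h1, finrank_span_image_finset hli, Finset.card_union_of_disjoint, Fin.card_filter_val_lt,
      min_eq_right hj]
    rw [Finset.disjoint_left]
    intro k hk hk'
    simp only [Finset.mem_filter, Finset.mem_univ, true_and] at hk hk'
    omega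
  have hmap : ∀ i ≤ p + q,
      finrank ℂ ((F.level i).map (proj p q)) = γ.rankPlus i + γ.rankCross i i := by
    intro i hi
    rw [h.map_level hi, γ.rankPlus_eq, γ.rankCross_eq, ← Finset.card_union_of_disjoint,
      ← finrank_span_image_finset hli, Finset.coe_union, Finset.coe_filter_univ,
      Finset.coe_filter_univ, Set.ofPred_or]
    · rw [Finset.disjoint_left]
      intro k hk hk'
      simp only [Finset.mem_filter, Finset.mem_univ, true_and] at hk hk'
      omega
  have hminus : ∀ i ≤ p + q, finrank ℂ ↥(F.level i ⊓ E' p q) = γ.rankMinus i := by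
    intro i hi
    have h1 := finrank_map_add_finrank_inf_ker (proj p q) (F.level i)
    rw [← E'_eq_ker, hmap i hi, F.finrank_level hi] at h1
    have := γ.rankPlus_add_rankMinus_add_rankCross hi
    omega
  rw [mem_Q_iff]
  refine ⟨fun i hi => ?_, hminus, fun i j hij hj => hcross i j hij.le hj⟩
  have h1 := finrank_map_proj_sup_level_self F hi
  rw [hcross i i le_rfl hi, hminus i hi] at h1
  have := γ.rankPlus_add_rankMinus_add_rankCross hi
  omega

/-- In `F` the vector `v k` first appears at level `m + 2`, so it becomes the closing vector at `l`.
The vector `v l`, corrected by a multiple of `v k` to lie in `F_{m+1}`, takes its place at `k`. -/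
lemma mem_adaptedFlags_of_swap {γ : Clan p q} {m : ℕ} {k l : Fin (p + q)} (hk : (k : ℕ) = m)
    (hl : (l : ℕ) = m + 1) (h1 : (γ.inv l : ℕ) < m) (h2 : m ≤ (γ.inv k : ℕ))
    {F F' : CompleteFlag (p + q)} {v : Fin (p + q) → Fin (p + q) → ℂ}
    (hv : IsAdaptedBasis (γ.swap k l) F' v) (hadj : CompleteFlag.Adjacent m F' F)
    (hvk : v k ∉ F.level (m + 1)) : F ∈ adaptedFlags γ := by
  have hm : m + 1 < p + q := by omega
  have hkl : k ≠ l := by rw [Ne, Fin.ext_iff]; omega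
  have hvk1 : v k ∈ F'.level (m + 1) := hk ▸ hv.mem k
  have hvl1 : v l ∈ F'.level (m + 2) := by
    have := hv.mem l; rwa [hl] at this
  have hvl2 : v l ∉ F'.level (m + 1) := hl ▸ hv.notMem l
  have hm2 := hadj (m + 2) (by omega) (by omega)
  have hm0 := hadj m (by omega) (by omega)
  have hvk2 : v k ∈ F.level (m + 2) := hm2 ▸ F'.level_mono (by omega) hvk1
  obtain ⟨t, ht⟩ := F.exists_sub_smul_mem hm (hm2 ▸ hvl1) hvk2 hvk
  have ha1 : Equiv.swap k l (γ.inv l) = γ.inv l :=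
    Equiv.swap_apply_of_ne_of_ne (by rw [Ne, Fin.ext_iff]; omega) (by rw [Ne, Fin.ext_iff]; omega)
  have hinvk : (γ.swap k l).inv k = γ.inv l := by
    rw [Clan.swap_inv_apply, Equiv.swap_apply_left, ha1]
  have hinva : (γ.swap k l).inv (γ.inv l) = k := by
    rw [← hinvk, Clan.inv_inv]
  have hpk : proj p q (v k) = v k :=
    hv.plusOrClosing k (Or.inr (by rw [hinvk, Fin.lt_def]; omega))
  have hpa : proj p q (v (γ.inv l)) = v k := by
    rw [hv.opening _ (by rw [hinva, Fin.lt_def]; omega), hinva]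
  have hva : v (γ.inv l) ∈ F'.level m := F'.level_mono (by omega) (hv.mem _)
  obtain ⟨z, hz1, hz2, hz3, hz4, hz5⟩ : ∃ z, z ∈ F.level (m + 1) ∧ z ∉ F.level m ∧
      (k ∈ γ.plus → proj p q z = z) ∧ (k ∈ γ.minus → proj p q z = 0) ∧
      (k < γ.inv k → proj p q z = v (γ.inv k)) := by
    have hz2 : v l - t • v k ∉ F.level m := fun h3 => hvl2 (by
      rw [← hm0] at h3
      rw [← sub_add_cancel (v l) (t • v k)]
      exact Submodule.add_mem _ (F'.level_mono (Nat.le_succ m) h3) (Submodule.smul_mem _ _ hvk1))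
    by_cases hp : k ∈ γ.plus
    · refine ⟨v l - t • v k, ht, hz2, fun _ => ?_,
        fun h3 => absurd h3 (γ.notMem_minus_of_mem_plus hp),
        fun h3 => absurd (γ.inv_eq_of_mem_plus hp) h3.ne'⟩
      rw [map_sub, map_smul, hpk, hv.plusOrClosing l (Or.inl (by
        rw [Clan.mem_swap_plus, Equiv.swap_apply_right]; exact hp))]
    -- If `k` carries a `-` or opens a pair, the correction `-t • v k` would spoil the image under
    -- `π`. Adding `t` times the opening vector, whose image is `v k` and which lies in `F_m`,
    -- cancels it.
    · have hpz : proj p q (v l - t • v k + t • v (γ.inv l)) = proj p q (v l) := by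
        rw [map_add, map_sub, map_smul, map_smul, hpk, hpa, sub_add_cancel]
      refine ⟨v l - t • v k + t • v (γ.inv l), Submodule.add_mem _ ht (Submodule.smul_mem _ _
        (F.level_mono (Nat.le_succ m) (hm0 ▸ hva))), fun h3 => hz2 ?_, fun h3 => absurd h3 hp,
        fun h3 => ?_, fun h3 => ?_⟩
      · rw [← add_sub_cancel_right (v l - t • v k) (t • v (γ.inv l))]
        exact Submodule.sub_mem _ h3 (Submodule.smul_mem _ _ (hm0 ▸ hva))
      · rw [hpz, hv.minus l]
        rw [Clan.mem_swap_minus, Equiv.swap_apply_right]; exact h3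
      · have h4 : γ.inv k ≠ l := fun e => by
          rw [γ.inv_eq_comm] at e; rw [e] at h1; omega
        have h5 : (γ.swap k l).inv l = γ.inv k := by
          rw [Clan.swap_inv_apply, Equiv.swap_apply_right,
            Equiv.swap_apply_of_ne_of_ne h3.ne' h4]
        have h6 : (γ.inv k : ℕ) ≠ m + 1 := fun e => h4 (Fin.ext (e.trans hl.symm))
        rw [hpz, hv.opening l (by rw [h5]; rw [Fin.lt_def] at h3 ⊢; omega), h5]
  let w : Fin (p + q) → Fin (p + q) → ℂ := Function.update (Function.update v l (v k)) k z
  have hwk : w k = z := Function.update_self _ _ _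
  have hwl : w l = v k := by
    simp only [w]
    rw [Function.update_of_ne hkl.symm, Function.update_self]
  have hw : ∀ x, x ≠ k → x ≠ l → w x = v x := fun x h3 h4 => by
    simp only [w]
    rw [Function.update_of_ne h3, Function.update_of_ne h4]
  have hne : ∀ x : Fin (p + q), x ≠ k → x ≠ l → (x : ℕ) ≠ m ∧ (x : ℕ) ≠ m + 1 := fun x h3 h4 =>
    ⟨fun e => h3 (Fin.ext (e.trans hk.symm)), fun e => h4 (Fin.ext (e.trans hl.symm))⟩
  refine ⟨w, fun x => ?_, fun x => ?_, fun x hx => ?_, fun x hx => ?_, fun x hx => ?_⟩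
  all_goals
    by_cases hxk : x = k
    · subst hxk
      simp only [hwk]
      first
      | exact hk ▸ hz1
      | exact hk ▸ hz2
      | exact hz4 hx
      | exact hx.elim hz3 fun h3 => absurd h3 (by rw [Fin.lt_def]; omega)
      | rw [hz5 hx, hw _ hx.ne' (fun e => by rw [γ.inv_eq_comm] at e; rw [e] at h1; omega)]
    by_cases hxl : x = l
    · subst hxl
      simp only [hwl]
      first
      | exact hl ▸ hvk2
      | exact hl ▸ hvk
      | exact hpk
      | exact absurd (γ.inv_eq_of_mem_minus hx) (by rw [Fin.ext_iff]; omega)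
      | exact absurd hx (by rw [Fin.lt_def]; omega)
    obtain ⟨hx1, hx2⟩ := hne x hxk hxl
    rw [hw x hxk hxl]
  · rw [← hadj _ (by omega) (by omega)]; exact hv.mem x
  · rw [← hadj _ (by omega) (by omega)]; exact hv.notMem x
  · refine hv.plusOrClosing x (hx.imp (fun h3 => ?_) fun h3 => ?_)
    · rw [Clan.mem_swap_plus, Equiv.swap_apply_of_ne_of_ne hxk hxl]; exact h3
    · rw [Clan.swap_inv_apply, Equiv.swap_apply_of_ne_of_ne hxk hxl]
      rw [Fin.lt_def] at h3 ⊢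
      rw [Clan.val_swap]
      split_ifs with h4 h5
      · have h6 : γ.inv x = k := Fin.ext h4
        rw [γ.inv_eq_comm] at h6
        rw [h6] at h2
        omega
      · omega
      · exact h3
  · refine hv.minus x ?_
    rw [Clan.mem_swap_minus, Equiv.swap_apply_of_ne_of_ne hxk hxl]; exact hx
  · by_cases hxa : γ.inv x = l
    · rw [hxa, hwl]
      rw [γ.inv_eq_comm] at hxa
      rw [← hxa]; exact hpa
    · have h3 : γ.inv x ≠ k := fun e => by
        have h4 := γ.inv_eq_comm.1 e
        rw [h4] at h2
        rw [e, Fin.lt_def] at hx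
        omega
      have h4 : (γ.swap k l).inv x = γ.inv x := by
        rw [Clan.swap_inv_apply, Equiv.swap_apply_of_ne_of_ne hxk hxl,
          Equiv.swap_apply_of_ne_of_ne h3 hxa]
      rw [hw _ h3 hxa, hv.opening x (by rwa [h4]), h4]

/-- Here `v k ∈ E` and `v l ∈ E'`. If `F_{m+1}` contains neither, it contains a vector `v l - t • v
k` with `t ≠ 0`, which opens a pair closed by its image `-(t • v k)`. -/
lemma mem_adaptedFlags_of_splitPair {γ : Clan p q} {m : ℕ} {k l : Fin (p + q)} (hk : (k : ℕ) = m)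
    (hl : (l : ℕ) = m + 1) (h : γ.inv k = l) (hkl : k ≠ l)
    {F F' : CompleteFlag (p + q)} {v : Fin (p + q) → Fin (p + q) → ℂ}
    (hv : IsAdaptedBasis (γ.splitPair k l h hkl) F' v) (hadj : CompleteFlag.Adjacent m F' F)
    (hvk : v k ∉ F.level (m + 1)) (hvl : v l ∉ F.level (m + 1)) : F ∈ adaptedFlags γ := by
  have hm : m + 1 < p + q := by omega
  have h' : γ.inv l = k := γ.inv_eq_comm.1 h
  have hvk1 : v k ∈ F'.level (m + 1) := hk ▸ hv.mem k
  have hvl1 : v l ∈ F'.level (m + 2) := by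
    have := hv.mem l; rwa [hl] at this
  have hvl2 : v l ∉ F'.level (m + 1) := hl ▸ hv.notMem l
  have hm2 := hadj (m + 2) (by omega) (by omega)
  have hm0 := hadj m (by omega) (by omega)
  have hvk2 : v k ∈ F.level (m + 2) := hm2 ▸ F'.level_mono (by omega) hvk1
  obtain ⟨t, ht⟩ := F.exists_sub_smul_mem hm (hm2 ▸ hvl1) hvk2 hvk
  have ht0 : t ≠ 0 := by
    rintro rfl
    rw [zero_smul, sub_zero] at ht
    exact hvl ht
  have hpk : proj p q (v k) = v k := hv.plusOrClosing k (Or.inl (by simp [Clan.splitPair]))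
  have hpl : proj p q (v l) = 0 := hv.minus l (by simp [Clan.splitPair])
  have hz2 : v l - t • v k ∉ F.level m := fun h3 => hvl2 (by
    rw [← hm0] at h3
    rw [← sub_add_cancel (v l) (t • v k)]
    exact Submodule.add_mem _ (F'.level_mono (Nat.le_succ m) h3) (Submodule.smul_mem _ _ hvk1))
  let w : Fin (p + q) → Fin (p + q) → ℂ :=
    Function.update (Function.update v l (-(t • v k))) k (v l - t • v k)
  have hwk : w k = v l - t • v k := Function.update_self _ _ _
  have hwl : w l = -(t • v k) := by
    simp only [w]
    rw [Function.update_of_ne hkl.symm, Function.update_self]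
  have hw : ∀ x, x ≠ k → x ≠ l → w x = v x := fun x h3 h4 => by
    simp only [w]
    rw [Function.update_of_ne h3, Function.update_of_ne h4]
  have hne : ∀ x : Fin (p + q), x ≠ k → x ≠ l → (x : ℕ) ≠ m ∧ (x : ℕ) ≠ m + 1 := fun x h3 h4 =>
    ⟨fun e => h3 (Fin.ext (e.trans hk.symm)), fun e => h4 (Fin.ext (e.trans hl.symm))⟩
  refine ⟨w, fun x => ?_, fun x => ?_, fun x hx => ?_, fun x hx => ?_, fun x hx => ?_⟩
  all_goals
    by_cases hxk : x = k
    · subst hxk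
      simp only [hwk]
      first
      | exact hk ▸ ht
      | exact hk ▸ hz2
      | exact absurd ((γ.inv_eq_of_mem_minus hx).symm.trans h) hkl
      | rw [h, hwl, map_sub, map_smul, hpl, hpk, zero_sub]
      | exact hx.elim (fun h3 => absurd ((γ.inv_eq_of_mem_plus h3).symm.trans h) hkl)
          fun h3 => absurd h3 (by rw [h, Fin.lt_def]; omega)
    by_cases hxl : x = l
    · subst hxl
      simp only [hwl]
      first
      | exact hl ▸ Submodule.neg_mem _ (Submodule.smul_mem _ _ hvk2)
      | exact hl ▸ fun h3 => hvk ((Submodule.smul_mem_iff _ ht0).1 ((Submodule.neg_mem_iff _).1 h3))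
      | exact absurd (h'.symm.trans (γ.inv_eq_of_mem_minus hx)) hkl
      | exact absurd hx (by rw [h', Fin.lt_def]; omega)
      | rw [map_neg, map_smul, hpk]
    obtain ⟨hx1, hx2⟩ := hne x hxk hxl
    have hinv : (γ.splitPair k l h hkl).inv x = γ.inv x := by
      rw [Clan.splitPair_inv_apply, if_neg (by tauto)]
    rw [hw x hxk hxl]
  · rw [← hadj _ (by omega) (by omega)]; exact hv.mem x
  · rw [← hadj _ (by omega) (by omega)]; exact hv.notMem x
  · refine hv.plusOrClosing x (hx.imp (fun h3 => Finset.mem_insert_of_mem h3) fun h3 => ?_)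
    rwa [hinv]
  · exact hv.minus x (Finset.mem_insert_of_mem hx)
  · rw [hw _ (fun e => hxl (by rw [← h, ← e, γ.inv_inv]))
      (fun e => hxk (by rw [← h', ← e, γ.inv_inv])), hv.opening x (by rwa [hinv]), hinv]

end

/-! ### Induction along descents: the rank equalities give an adapted basis. -/

section

variable {p q : ℕ}

/-- A descent along which adapted bases can be transported. -/
structure IsAdaptedDescent (m : ℕ) (γ' γ : Clan p q) : Prop extends Clan.IsDescent m γ' γ where
  mem_of_mem_Q : ∀ F F', CompleteFlag.Adjacent m F' F → F ∈ Q γ → F' ∈ adaptedFlags γ' →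
    F ∈ adaptedFlags γ
  exists_generic : ∀ F' ∈ adaptedFlags γ', ∃ y₁ y₂, y₁ ∉ F'.level m ∧ y₂ ∉ F'.level m ∧
    ∀ F, CompleteFlag.Adjacent m F' F → y₁ ∉ F.level (m + 1) → y₂ ∉ F.level (m + 1) →
      F ∈ adaptedFlags γ

lemma isAdaptedDescent_swap {γ : Clan p q} {m : ℕ} {k l : Fin (p + q)} (hk : (k : ℕ) = m)
    (hl : (l : ℕ) = m + 1) (h1 : (γ.inv l : ℕ) < m) (h2 : m ≤ (γ.inv k : ℕ)) :
    IsAdaptedDescent m (γ.swap k l) γ where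
  toIsDescent := γ.isDescent_swap hk hl h1 h2
  mem_of_mem_Q := by
    rintro F F' hadj hF hF'
    have hd := γ.isDescent_swap hk hl h1 h2
    have hm := hd.lt
    have hF2 := adaptedFlags_subset_Q _ hF'
    obtain ⟨v, hv⟩ := hF'
    -- If `v k` lay in `F_{m+1}`, the two flags would coincide at level `m + 1`, although the cross
    -- ranks of the two clans differ there.
    refine mem_adaptedFlags_of_swap hk hl h1 h2 hv hadj fun h3 => ?_
    have hvk : v k ∈ F'.level (m + 1) := hk ▸ hv.mem k
    have hvk' : v k ∉ F'.level m := hk ▸ hv.notMem k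
    have hm0 := hadj m (by omega) (by omega)
    have h4 : F'.level (m + 1) = F.level (m + 1) := by
      rw [← sup_span_singleton_eq_of_finrank (F.level_mono (Nat.le_succ m)) h3 (hm0 ▸ hvk')
        (by rw [F.finrank_level (by omega), F.finrank_level (by omega)]),
        ← sup_span_singleton_eq_of_finrank (F'.level_mono (Nat.le_succ m)) hvk hvk'
        (by rw [F'.finrank_level (by omega), F'.finrank_level (by omega)]), hm0]
    have e1 := finrank_cross_eq hF (le_refl (m + 1)) (by omega)
    have e2 := finrank_cross_eq hF2 (le_refl (m + 1)) (by omega)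
    rw [h4] at e2
    have := hd.rankCross_lt
    omega
  exists_generic := by
    rintro F' ⟨v, hv⟩
    have hvk' : v k ∉ F'.level m := hk ▸ hv.notMem k
    exact ⟨v k, v k, hvk', hvk', fun F hadj h3 _ =>
      mem_adaptedFlags_of_swap hk hl h1 h2 hv hadj h3⟩

lemma isAdaptedDescent_splitPair {γ : Clan p q} {m : ℕ} {k l : Fin (p + q)} (hk : (k : ℕ) = m)
    (hl : (l : ℕ) = m + 1) (h : γ.inv k = l) (hkl : k ≠ l) :
    IsAdaptedDescent m (γ.splitPair k l h hkl) γ where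
  toIsDescent := γ.isDescent_splitPair hk hl h hkl
  mem_of_mem_Q := by
    rintro F F' hadj hF ⟨v, hv⟩
    have hm : m + 1 < p + q := by omega
    obtain ⟨hP, hM, -⟩ := mem_Q_iff.1 hF
    have hm0 := hadj m (by omega) (by omega)
    have hpk : proj p q (v k) = v k := hv.plusOrClosing k (Or.inl (by simp [Clan.splitPair]))
    have hpl : proj p q (v l) = 0 := hv.minus l (by simp [Clan.splitPair])
    have hvk : v k ∉ F'.level m := hk ▸ hv.notMem k
    have hvl : v l ∉ F'.level m := fun h3 =>
      hv.notMem l (by rw [hl]; exact F'.level_mono (Nat.le_succ m) h3)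
    have hcl : ¬ γ.inv k < k := by rw [h, Fin.lt_def]; omega
    have hp : ¬ γ.PlusOrClosing k := by
      rintro (h3 | h3)
      · exact hkl ((γ.inv_eq_of_mem_plus h3).symm.trans h)
      · exact hcl h3
    have hq : ¬ γ.MinusOrClosing k := by
      rintro (h3 | h3)
      · exact hkl ((γ.inv_eq_of_mem_minus h3).symm.trans h)
      · exact hcl h3
    have hp' := γ.rankPlus_succ k
    have hq' := γ.rankMinus_succ k
    rw [if_neg hp, hk, ← hP _ (by omega), ← hP _ (by omega)] at hp'
    rw [if_neg hq, hk, ← hM _ (by omega), ← hM _ (by omega)] at hq'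
    -- Position `k` opens a pair of `γ`, so neither `F_i ∩ E` nor `F_i ∩ E'` grows from `i = m` to
    -- `m + 1`. This excludes `v k` and `v l` from `F_{m+1}`.
    refine mem_adaptedFlags_of_splitPair hk hl h hkl hv hadj (fun h3 => ?_) fun h3 => ?_
    · have := finrank_lt_finrank_of_mem (inf_le_inf_right (E p q) (F.level_mono (Nat.le_add_right m 1)))
        ⟨h3, mem_E_iff.2 hpk⟩ fun h4 => hvk (hm0 ▸ h4.1)
      omega
    · have := finrank_lt_finrank_of_mem (inf_le_inf_right (E' p q) (F.level_mono (Nat.le_add_right m 1)))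
        ⟨h3, mem_E'_iff.2 hpl⟩ fun h4 => hvl (hm0 ▸ h4.1)
      omega
  exists_generic := by
    rintro F' ⟨v, hv⟩
    have hvk : v k ∉ F'.level m := hk ▸ hv.notMem k
    have hvl : v l ∉ F'.level m := fun h3 =>
      hv.notMem l (by rw [hl]; exact F'.level_mono (Nat.le_succ m) h3)
    exact ⟨v k, v l, hvk, hvl, fun F hadj h3 h4 =>
      mem_adaptedFlags_of_splitPair hk hl h hkl hv hadj h3 h4⟩

/-- Without pairs the lower bounds for the two intersections add up to `i`, the largest possible
total, so they are equalities. At each step the intersection named by the sign grows and supplies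
the basis vector. No condition on `π(F_i) + F_j` is needed. -/
lemma rankLocus_subset_adaptedFlags {γ : Clan p q} (h : ∀ k, γ.inv k = k) :
    rankLocus γ ⊆ adaptedFlags γ := by
  intro F hF
  obtain ⟨hP, hM, -⟩ := mem_rankLocus_iff.1 hF
  have hdim : ∀ i ≤ p + q, finrank ℂ ↥(F.level i ⊓ E p q) = γ.rankPlus i ∧
      finrank ℂ ↥(F.level i ⊓ E' p q) = γ.rankMinus i := by
    intro i hi
    have h1 := finrank_map_proj_sup_level_self F hi
    have h2 : finrank ℂ (F.level i) ≤ finrank ℂ ↥((F.level i).map (proj p q) ⊔ F.level i) :=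
      Submodule.finrank_mono le_sup_right
    rw [F.finrank_level hi] at h2
    have h3 := γ.rankPlus_add_rankMinus_add_rankCross hi
    have h4 : γ.rankCross i i = 0 := by
      unfold Clan.rankCross
      rw [Finset.card_eq_zero, Finset.filter_eq_empty_iff]
      intro k _
      rw [h k]
      omega
    have := hP i hi
    have := hM i hi
    omega
  have hv : ∀ k : Fin (p + q), ∃ v, v ∈ F.level (k + 1) ∧ v ∉ F.level k ∧
      (k ∈ γ.plus → proj p q v = v) ∧ (k ∈ γ.minus → proj p q v = 0) := by
    intro k
    have hk := k.2
    obtain ⟨p1, m1⟩ := hdim k (by omega)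
    obtain ⟨p2, m2⟩ := hdim (k + 1) (by omega)
    rcases (γ.fixed_iff k).1 (h k) with h1 | h1
    · have h2 := γ.rankPlus_succ k
      rw [if_pos (Or.inl h1)] at h2
      obtain ⟨v, ⟨hv1, hv2⟩, hv3⟩ := exists_mem_notMem_of_finrank_lt (S := F.level k ⊓ E p q)
        (T := F.level (k + 1) ⊓ E p q) (by omega)
      exact ⟨v, hv1, fun h3 => hv3 ⟨h3, hv2⟩, fun _ => mem_E_iff.1 hv2,
        fun h3 => absurd h3 (γ.notMem_minus_of_mem_plus h1)⟩
    · have h2 := γ.rankMinus_succ k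
      rw [if_pos (Or.inl h1)] at h2
      obtain ⟨v, ⟨hv1, hv2⟩, hv3⟩ := exists_mem_notMem_of_finrank_lt (S := F.level k ⊓ E' p q)
        (T := F.level (k + 1) ⊓ E' p q) (by omega)
      exact ⟨v, hv1, fun h3 => hv3 ⟨h3, hv2⟩,
        fun h3 => absurd h1 (γ.notMem_minus_of_mem_plus h3), fun _ => mem_E'_iff.1 hv2⟩
  choose v hv1 hv2 hv3 hv4 using hv
  exact ⟨v, hv1, hv2, fun k hk => hv3 k (hk.resolve_right (by rw [h k]; exact lt_irrefl k)), hv4,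
    fun k hk => absurd hk (by rw [h k]; exact lt_irrefl k)⟩

/-- Induction on clans along descents, starting from the clans consisting of signs. -/
lemma Clan.descent_induction {P : Clan p q → Prop} (base : ∀ γ, (∀ k, γ.inv k = k) → P γ)
    (step : ∀ m γ' γ, IsAdaptedDescent m γ' γ → P γ' → P γ) (γ : Clan p q) : P γ := by
  induction hN : ∑ i ∈ Finset.range (p + q), γ.rankCross i i using Nat.strong_induction_on
    generalizing γ with
  | _ N ih =>
    rcases γ.forall_inv_eq_or_exists_descent with h | ⟨m, k, l, hk, hl, h | ⟨h1, h2⟩⟩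
    · exact base γ h
    · have hkl : k ≠ l := by rw [Ne, Fin.ext_iff]; omega
      have hd := isAdaptedDescent_splitPair hk hl h hkl
      exact step m _ γ hd (ih _ (hN ▸ hd.sum_rankCross_lt) _ rfl)
    · have hd := isAdaptedDescent_swap hk hl h1 h2
      exact step m _ γ hd (ih _ (hN ▸ hd.sum_rankCross_lt) _ rfl)

/-- A flag of `Q γ` is moved to an adjacent flag satisfying the inequalities of the descent, which
then satisfies its equalities; induction provides an adapted basis there, and it is transported
back. -/
lemma Q_eq_adaptedFlags (γ : Clan p q) : Q γ = adaptedFlags γ := by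
  refine Set.Subset.antisymm ?_ (adaptedFlags_subset_Q γ)
  induction γ using Clan.descent_induction with
  | base γ h => exact (Q_subset_rankLocus γ).trans (rankLocus_subset_adaptedFlags h)
  | step m γ' γ hd ih =>
    intro F hF
    obtain ⟨F', hF', hadj⟩ := exists_adjacent_mem_rankLocus hd.toIsDescent (Q_subset_rankLocus γ hF)
    exact hd.mem_of_mem_Q F F' hadj.symm hF (ih (mem_Q_of_adjacent hd.toIsDescent hF hadj hF'))

end

/-! ### Zariski closures in `GL_n` and density of `Q γ` in the rank locus. -/

section

section GeneralLinearGroup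

variable {n : ℕ}

lemma CompleteFlag.level_smul (g : GL (Fin n) ℂ) (F : CompleteFlag n) (i : ℕ) :
    (g • F).level i = (F.level i).map (g : Matrix (Fin n) (Fin n) ℂ).mulVecLin := rfl

lemma CompleteFlag.Adjacent.smul {m : ℕ} {F F' : CompleteFlag n} (h : Adjacent m F F')
    (g : GL (Fin n) ℂ) : Adjacent m (g • F) (g • F') := fun i hi hi' => by
  rw [level_smul, level_smul, h i hi hi']

lemma level_standardFlag {i : ℕ} (hi : i ≤ n) : (standardFlag n).level i =
    Submodule.span ℂ ((fun k : Fin n => (Pi.single k 1 : Fin n → ℂ)) '' {k | (k : ℕ) < i}) :=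
  (standardFlag n).level_val ⟨i, by omega⟩

lemma level_smul_standardFlag (g : GL (Fin n) ℂ) {i : ℕ} (hi : i ≤ n) :
    (g • standardFlag n).level i = Submodule.span ℂ
      ((fun k : Fin n => (g : Matrix (Fin n) (Fin n) ℂ).col k) '' {k | (k : ℕ) < i}) := by
  rw [CompleteFlag.level_smul, level_standardFlag hi, Submodule.map_span, Set.image_image]
  simp only [Matrix.mulVecLin_apply, Matrix.mulVec_single_one]

lemma exists_smul_standardFlag_of_linearIndependent {v : Fin n → Fin n → ℂ}
    (hv : LinearIndependent ℂ v) : ∃ g : GL (Fin n) ℂ,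
      ∀ k, (g : Matrix (Fin n) (Fin n) ℂ).col k = v k := by
  have hu : IsUnit (Matrix.of fun i k => v k i) := by
    rw [← Matrix.linearIndependent_cols_iff_isUnit]
    exact hv
  exact ⟨hu.unit, fun k => rfl⟩

lemma exists_smul_standardFlag_eq (F : CompleteFlag n) :
    ∃ g : GL (Fin n) ℂ, g • standardFlag n = F := by
  have h : ∀ k : Fin n, ∃ v, v ∈ F.level (k + 1) ∧ v ∉ F.level k := fun k =>
    exists_mem_notMem_of_finrank_lt (by
      rw [F.finrank_level (by omega), F.finrank_level (by omega)]; omega)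
  choose v hv hv' using h
  obtain ⟨g, hg⟩ := exists_smul_standardFlag_of_linearIndependent
    (CompleteFlag.linearIndependent_of_mem_level hv hv')
  refine ⟨g, CompleteFlag.ext_level fun i hi => ?_⟩
  rw [level_smul_standardFlag g hi, CompleteFlag.level_eq_span hv hv' hi]
  simp only [hg]

/-- The value of a polynomial in the matrix entries. -/
noncomputable abbrev evalGL (g : GL (Fin n) ℂ) : MvPolynomial (Fin n × Fin n) ℂ →+* ℂ :=
  MvPolynomial.eval fun ij => (g : Matrix (Fin n) (Fin n) ℂ) ij.1 ij.2

/-- The Zariski closure of a subset of `GL_n`. -/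
def zariskiClosure (A : Set (GL (Fin n) ℂ)) : Set (GL (Fin n) ℂ) :=
  {g | ∀ f, (∀ a ∈ A, evalGL a f = 0) → evalGL g f = 0}

lemma subset_zariskiClosure (A : Set (GL (Fin n) ℂ)) : A ⊆ zariskiClosure A :=
  fun a ha _ hf => hf a ha

lemma isClosed_zariskiGL_iff {Z : Set (GL (Fin n) ℂ)} : @IsClosed _ (zariskiGL n) Z ↔
    ∃ S : Set (MvPolynomial (Fin n × Fin n) ℂ), Z = zeroSet S := by
  rw [← @isOpen_compl_iff _ _ (zariskiGL n)]
  change Zᶜᶜ ∈ _ ↔ _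
  rw [compl_compl]
  rfl

lemma isClosed_flags_iff {Z : Set (CompleteFlag n)} : IsClosed Z ↔
    ∃ S : Set (MvPolynomial (Fin n × Fin n) ℂ),
      {g : GL (Fin n) ℂ | g • standardFlag n ∈ Z} = zeroSet S := by
  rw [← isClosed_zariskiGL_iff]
  exact @isClosed_coinduced _ _ (zariskiGL n) _ _

lemma smul_mem_closure_of_mem_zariskiClosure {S : Set (CompleteFlag n)} {g : GL (Fin n) ℂ}
    (hg : g ∈ zariskiClosure {a : GL (Fin n) ℂ | a • standardFlag n ∈ S}) :
    g • standardFlag n ∈ closure S := by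
  obtain ⟨T, hT⟩ := isClosed_flags_iff.1 (isClosed_closure (s := S))
  change g ∈ {g : GL (Fin n) ℂ | g • standardFlag n ∈ closure S}
  rw [hT]
  intro f hf
  refine hg f fun a ha => ?_
  have h1 : a ∈ {g : GL (Fin n) ℂ | g • standardFlag n ∈ closure S} := subset_closure ha
  rw [hT] at h1
  exact h1 f hf

/-- Right translation by `x` is polynomial in the entries, so an equation of `B` pulls back to an
equation of `A`. -/
lemma mul_mem_zariskiClosure {A B : Set (GL (Fin n) ℂ)} {g x : GL (Fin n) ℂ}
    (hg : g ∈ zariskiClosure A) (h : ∀ a ∈ A, a * x ∈ zariskiClosure B) :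
    g * x ∈ zariskiClosure B := by
  intro f hf
  let f' : MvPolynomial (Fin n × Fin n) ℂ := MvPolynomial.bind₁ (fun ij : Fin n × Fin n =>
    ∑ k, MvPolynomial.X (ij.1, k) * MvPolynomial.C ((x : Matrix (Fin n) (Fin n) ℂ) k ij.2)) f
  have key : ∀ a : GL (Fin n) ℂ, evalGL a f' = evalGL (a * x) f := by
    intro a
    simp only [f', evalGL]
    rw [← MvPolynomial.coe_aeval_eq_eval, ← MvPolynomial.coe_aeval_eq_eval, RingHom.coe_coe,
      RingHom.coe_coe, MvPolynomial.aeval_bind₁]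
    congr 2
    ext ij
    simp [Matrix.mul_apply]
  rw [← key]
  exact hg f' fun a ha => by rw [key]; exact h a ha f hf

/-- The transvection adding `t` times the column `l` to the column `k`. -/
def transvectionGL {k l : Fin n} (h : l ≠ k) (t : ℂ) : GL (Fin n) ℂ where
  val := Matrix.transvection l k t
  inv := Matrix.transvection l k (-t)
  val_inv := by rw [Matrix.transvection_mul_transvection_same _ _ h, add_neg_cancel,
    Matrix.transvection_zero]
  inv_val := by rw [Matrix.transvection_mul_transvection_same _ _ h, neg_add_cancel,
    Matrix.transvection_zero]

lemma mul_transvectionGL_apply {k l : Fin n} (h : l ≠ k) (t : ℂ) (g : GL (Fin n) ℂ) (i j : Fin n) :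
    ((g * transvectionGL h t : GL (Fin n) ℂ) : Matrix (Fin n) (Fin n) ℂ) i j =
      (g : Matrix (Fin n) (Fin n) ℂ) i j +
        t * if j = k then (g : Matrix (Fin n) (Fin n) ℂ) i l else 0 := by
  change ((g : Matrix (Fin n) (Fin n) ℂ) * Matrix.transvection l k t) i j = _
  by_cases hj : j = k
  · subst hj
    rw [Matrix.mul_transvection_apply_same, if_pos rfl]
  · rw [Matrix.mul_transvection_apply_of_ne _ _ _ _ hj, if_neg hj, mul_zero, add_zero]

/-- Restricted to the line of transvections, an equation of `A` is a one-variable polynomial with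
infinitely many roots. It is therefore zero, and the parameter `0` gives `g` itself. -/
lemma mem_zariskiClosure_of_infinite {A : Set (GL (Fin n) ℂ)} {k l : Fin n} (h : l ≠ k)
    {g : GL (Fin n) ℂ} (hA : {t : ℂ | g * transvectionGL h t ∈ A}.Infinite) :
    g ∈ zariskiClosure A := by
  intro f hf
  let P : Polynomial ℂ := MvPolynomial.eval₂ Polynomial.C (fun ij : Fin n × Fin n =>
    Polynomial.C ((g : Matrix (Fin n) (Fin n) ℂ) ij.1 ij.2) + Polynomial.X *
      Polynomial.C (if ij.2 = k then (g : Matrix (Fin n) (Fin n) ℂ) ij.1 l else 0)) f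
  have key : ∀ t, P.eval t = evalGL (g * transvectionGL h t) f := by
    intro t
    simp only [P, evalGL]
    rw [← Polynomial.coe_evalRingHom, MvPolynomial.hom_eval₂, MvPolynomial.eval,
      MvPolynomial.coe_eval₂Hom]
    congr 1
    · ext z; simp
    · ext ij
      rw [mul_transvectionGL_apply]
      simp only [Polynomial.coe_evalRingHom, Polynomial.eval_add, Polynomial.eval_mul,
        Polynomial.eval_C, Polynomial.eval_X]
  have hP : P = 0 := by
    refine Polynomial.eq_zero_of_infinite_isRoot P (hA.mono fun t ht => ?_)
    change P.eval t = 0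
    rw [key]
    exact hf _ ht
  have h0 := key 0
  rw [hP, Polynomial.eval_zero] at h0
  have h1 : transvectionGL h (0 : ℂ) = 1 := Units.ext (Matrix.transvection_zero _ _)
  rw [h0, h1, mul_one]

/-- Adding column `m + 1` to column `m` alters the span of the first `i` columns only for `i = m +
1`: before that column `m` is absent, afterwards both are present. -/
lemma adjacent_transvectionGL {m : ℕ} {k l : Fin n} (hk : (k : ℕ) = m) (hl : (l : ℕ) = m + 1)
    (h : l ≠ k) (t : ℂ) :
    CompleteFlag.Adjacent m (transvectionGL h t • standardFlag n) (standardFlag n) := by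
  intro i hi hi'
  refine Submodule.eq_of_le_of_finrank_eq ?_
    (by rw [CompleteFlag.finrank_level _ hi, CompleteFlag.finrank_level _ hi])
  rw [level_smul_standardFlag _ hi, Submodule.span_le]
  rintro _ ⟨j, hj, rfl⟩
  have hj' : (j : ℕ) < i := hj
  rw [level_standardFlag hi, SetLike.mem_coe, mem_span_single_iff]
  intro x hx
  have hx' : ¬ (x : ℕ) < i := hx
  have h1 := mul_transvectionGL_apply h t 1 x j
  rw [one_mul] at h1
  beta_reduce
  rw [Matrix.col_apply, h1]
  have h2 : x ≠ j := by rintro rfl; exact hx' hj'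
  rw [Units.val_one, Matrix.one_apply_ne h2, zero_add]
  split_ifs with h3
  · subst h3
    have h4 : x ≠ l := by rintro rfl; omega
    rw [Matrix.one_apply_ne h4, mul_zero]
  · rw [mul_zero]

/-- Along the transvections, a vector outside of the `m`-th space belongs to the `(m+1)`-st space for
at most one value of the parameter. -/
lemma subsingleton_mem_level_transvectionGL {m : ℕ} {k l : Fin n} (hk : (k : ℕ) = m)
    (hl : (l : ℕ) = m + 1) (h : l ≠ k) (g : GL (Fin n) ℂ) {y : Fin n → ℂ}
    (hy : y ∉ (g • standardFlag n).level m) :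
    {t : ℂ | y ∈ ((g * transvectionGL h t) • standardFlag n).level (m + 1)}.Subsingleton := by
  intro t ht t' ht'
  by_contra hne
  have hm : m + 1 < n := by omega
  have hadj : ∀ s, CompleteFlag.Adjacent m ((g * transvectionGL h s) • standardFlag n)
      (g • standardFlag n) := by
    intro s
    rw [mul_smul]
    exact (adjacent_transvectionGL hk hl h s).smul g
  have hmem : ∀ s, (g : Matrix (Fin n) (Fin n) ℂ).col k + s • (g : Matrix (Fin n) (Fin n) ℂ).col l ∈
      ((g * transvectionGL h s) • standardFlag n).level (m + 1) := by
    intro s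
    rw [level_smul_standardFlag _ (by omega)]
    refine Submodule.subset_span ⟨k, by change (k : ℕ) < m + 1; omega, ?_⟩
    ext i
    have h1 := mul_transvectionGL_apply h s g i k
    rwa [if_pos rfl] at h1
  have hU : ∀ s, y ∈ ((g * transvectionGL h s) • standardFlag n).level (m + 1) →
      (g • standardFlag n).level m ⊔ ℂ ∙ y =
        ((g * transvectionGL h s) • standardFlag n).level (m + 1) := by
    intro s hs
    refine sup_span_singleton_eq_of_finrank ?_ hs hy (by
      rw [CompleteFlag.finrank_level _ (by omega), CompleteFlag.finrank_level _ (by omega)])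
    rw [← hadj s m (by omega) (by omega)]
    exact CompleteFlag.level_mono _ (by omega)
  -- Two parameters would give the same space `U` at level `m + 1`. It would then contain columns
  -- `m` and `m + 1` and hence all of level `m + 2`, which is too large.
  set U := (g • standardFlag n).level m ⊔ ℂ ∙ y with hUdef
  have h1 := hmem t
  have h2 := hmem t'
  rw [← hU t ht] at h1
  rw [← hU t' ht'] at h2
  have hcl : (g : Matrix (Fin n) (Fin n) ℂ).col l ∈ U := by
    have h3 := Submodule.sub_mem _ h1 h2
    rw [add_sub_add_left_eq_sub, ← sub_smul] at h3
    exact (Submodule.smul_mem_iff _ (sub_ne_zero.2 hne)).1 h3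
  have hck : (g : Matrix (Fin n) (Fin n) ℂ).col k ∈ U := by
    have h3 := Submodule.sub_mem _ h1 (Submodule.smul_mem _ t hcl)
    rwa [add_sub_cancel_right] at h3
  have hle : (g • standardFlag n).level (m + 2) ≤ U := by
    rw [level_smul_standardFlag _ (by omega), Submodule.span_le]
    rintro _ ⟨j, hj, rfl⟩
    have hj' : (j : ℕ) < m + 2 := hj
    by_cases hjk : j = k
    · rw [hjk]; exact hck
    by_cases hjl : j = l
    · rw [hjl]; exact hcl
    · refine Submodule.mem_sup_left ?_
      rw [level_smul_standardFlag _ (by omega)]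
      refine Submodule.subset_span ⟨j, ?_, rfl⟩
      change (j : ℕ) < m
      rw [Fin.ext_iff] at hjk hjl
      omega
  have h3 := Submodule.finrank_mono hle
  rw [hU t ht, CompleteFlag.finrank_level _ (by omega), CompleteFlag.finrank_level _ (by omega)] at h3
  omega

end GeneralLinearGroup

variable {p q : ℕ}

lemma mem_zariskiClosure_of_mem_rankLocus (γ : Clan p q) :
    ∀ g : GL (Fin (p + q)) ℂ, g • standardFlag (p + q) ∈ rankLocus γ →
      g ∈ zariskiClosure {a : GL (Fin (p + q)) ℂ | a • standardFlag (p + q) ∈ Q γ} := by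
  induction γ using Clan.descent_induction with
  | base γ h =>
    exact fun g hg => subset_zariskiClosure _
      (adaptedFlags_subset_Q γ (rankLocus_subset_adaptedFlags h hg))
  | step m γ' γ hd ih =>
    intro g hg
    obtain ⟨F', hF', hadj⟩ := exists_adjacent_mem_rankLocus hd.toIsDescent hg
    obtain ⟨g', rfl⟩ := exists_smul_standardFlag_eq F'
    -- Write `g = g' * x`. By induction `g'` is in the closure for `γ'`, so it suffices to treat `a
    -- * x` with `a` representing a flag of `Q γ'`. The flags of `a` and `a * x` are again adjacent,
    -- since left translation preserves adjacency.
    rw [← mul_inv_cancel_left g' g]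
    refine mul_mem_zariskiClosure (ih g' hF') fun a ha => ?_
    have hm := hd.lt
    have hkl : (⟨m + 1, hm⟩ : Fin (p + q)) ≠ ⟨m, by omega⟩ := by simp
    have hadj' : CompleteFlag.Adjacent m (a • standardFlag (p + q))
        ((a * (g'⁻¹ * g)) • standardFlag (p + q)) := by
      have h1 := (hadj.symm.smul g'⁻¹).smul a
      rwa [inv_smul_smul, ← mul_smul, ← mul_smul, mul_assoc] at h1
    obtain ⟨y₁, y₂, h1, h2, h3⟩ := hd.exists_generic _ (Q_eq_adaptedFlags γ' ▸ ha)
    rw [hadj' m (by omega) (by omega)] at h1 h2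
    have s1 := subsingleton_mem_level_transvectionGL (m := m) rfl rfl hkl _ h1
    have s2 := subsingleton_mem_level_transvectionGL (m := m) rfl rfl hkl _ h2
    -- Each of the two vectors to be avoided excludes at most one transvection parameter; all the
    -- others give flags of `Q γ`.
    refine mem_zariskiClosure_of_infinite hkl
      ((s1.finite.union s2.finite).infinite_compl.mono fun t ht => ?_)
    rw [Set.mem_compl_iff, Set.mem_union, not_or] at ht
    refine adaptedFlags_subset_Q γ (h3 _ (hadj'.trans ?_) ht.1 ht.2)
    rw [mul_smul _ (transvectionGL hkl t)]
    exact ((adjacent_transvectionGL rfl rfl hkl t).smul _).symm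

lemma rankLocus_subset_closure_Q (γ : Clan p q) : rankLocus γ ⊆ closure (Q γ) := by
  intro F hF
  obtain ⟨g, rfl⟩ := exists_smul_standardFlag_eq F
  exact smul_mem_closure_of_mem_zariskiClosure (mem_zariskiClosure_of_mem_rankLocus γ g hF)

end

/-! ### The rank inequalities are determinantal, hence closed. -/

section

section Determinantal

variable {n : ℕ}

/-- The matrix of variables. -/
noncomputable def genericMatrix (n : ℕ) : Matrix (Fin n) (Fin n) (MvPolynomial (Fin n × Fin n) ℂ) :=
  Matrix.of fun i j => MvPolynomial.X (i, j)

/-- A minor of `A g X + g Y`, up to a change of coordinates, as a polynomial in the entries of `g`. -/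
noncomputable def minorPolynomial {r : ℕ} (A : Matrix (Fin n) (Fin n) ℂ)
    (Φ : Matrix (Fin r) (Fin n) ℂ) (X Y : Matrix (Fin n) (Fin r) ℂ) :
    MvPolynomial (Fin n × Fin n) ℂ :=
  let c : ℂ →+* MvPolynomial (Fin n × Fin n) ℂ := MvPolynomial.C
  (Φ.map c * (A.map c * (genericMatrix n * X.map c) + genericMatrix n * Y.map c)).det

lemma evalGL_minorPolynomial {r : ℕ} (A : Matrix (Fin n) (Fin n) ℂ)
    (Φ : Matrix (Fin r) (Fin n) ℂ) (X Y : Matrix (Fin n) (Fin r) ℂ) (g : GL (Fin n) ℂ) :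
    evalGL g (minorPolynomial A Φ X Y) =
      (Φ * (A * ((g : Matrix (Fin n) (Fin n) ℂ) * X) + (g : Matrix (Fin n) (Fin n) ℂ) * Y)).det := by
  have hC : ∀ {a b : ℕ} (M : Matrix (Fin a) (Fin b) ℂ),
      (M.map (MvPolynomial.C (σ := Fin n × Fin n))).map (evalGL g) = M := fun M => by
    ext i j; simp
  have hG : (genericMatrix n).map (evalGL g) = (g : Matrix (Fin n) (Fin n) ℂ) := by
    ext i j; simp [genericMatrix]
  unfold minorPolynomial
  rw [RingHom.map_det, RingHom.mapMatrix_apply, Matrix.map_mul, Matrix.map_add _ (map_add _),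
    Matrix.map_mul, Matrix.map_mul, Matrix.map_mul, hC, hC, hC, hC, hG]

/-- The dimension exceeds `r` iff some `r + 1` vectors `A g x + g y`, with `x ∈ S` and `y ∈ T`, are
independent, that is, iff some linear map to `ℂ^{r+1}` makes them a basis. The equations are the
corresponding determinants. -/
lemma exists_zeroSet_finrank_le (A : Matrix (Fin n) (Fin n) ℂ) (S T : Submodule ℂ (Fin n → ℂ))
    (r : ℕ) : ∃ Z : Set (MvPolynomial (Fin n × Fin n) ℂ), {g : GL (Fin n) ℂ | finrank ℂ
      ↥((S.map (g : Matrix (Fin n) (Fin n) ℂ).mulVecLin).map A.mulVecLin ⊔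
        T.map (g : Matrix (Fin n) (Fin n) ℂ).mulVecLin) ≤ r} = zeroSet Z := by
  refine ⟨{f | ∃ (Φ : Matrix (Fin (r + 1)) (Fin n) ℂ) (X Y : Matrix (Fin n) (Fin (r + 1)) ℂ),
    (∀ c, X.col c ∈ S) ∧ (∀ c, Y.col c ∈ T) ∧ f = minorPolynomial A Φ X Y}, ?_⟩
  ext g
  set G := (g : Matrix (Fin n) (Fin n) ℂ) with hG
  set W := (S.map G.mulVecLin).map A.mulVecLin ⊔ T.map G.mulVecLin with hW
  have hcol : ∀ (X Y : Matrix (Fin n) (Fin (r + 1)) ℂ) c,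
      (A * (G * X) + G * Y).col c = A *ᵥ (G *ᵥ X.col c) + G *ᵥ Y.col c := by
    exact fun X Y c => rfl
  constructor
  · rintro (hle : finrank ℂ W ≤ r) _ ⟨Φ, X, Y, hX, hY, rfl⟩
    refine (evalGL_minorPolynomial A Φ X Y g).trans ?_
    by_contra hdet
    have hli := Matrix.linearIndependent_cols_iff_isUnit.2
      ((Matrix.isUnit_iff_isUnit_det _).2 (isUnit_iff_ne_zero.2 hdet))
    have hli' : LinearIndependent ℂ (A * (G * X) + G * Y).col := by
      exact LinearIndependent.of_comp Φ.mulVecLin hli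
    have h1 : Submodule.span ℂ (Set.range (A * (G * X) + G * Y).col) ≤ W := by
      rw [Submodule.span_le]
      rintro _ ⟨c, rfl⟩
      rw [hcol]
      exact Submodule.add_mem_sup
        (Submodule.mem_map_of_mem (f := A.mulVecLin) (Submodule.mem_map_of_mem (f := G.mulVecLin)
          (hX c)))
        (Submodule.mem_map_of_mem (f := G.mulVecLin) (hY c))
    have h2 := Submodule.finrank_mono h1
    rw [finrank_span_eq_card hli', Fintype.card_fin] at h2
    omega
  · intro hg
    by_contra hlt
    have hlt' : ¬ finrank ℂ W ≤ r := hlt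
    obtain ⟨u, hu⟩ := exists_linearIndependent_of_le_finrank (n := r + 1) (M := W) (R := ℂ) (by omega)
    have hxy : ∀ c, ∃ x ∈ S, ∃ y ∈ T, A *ᵥ (G *ᵥ x) + G *ᵥ y = (u c : Fin n → ℂ) := by
      intro c
      obtain ⟨_, ⟨_, ⟨x, hx, rfl⟩, rfl⟩, _, ⟨y, hy, rfl⟩, h⟩ := Submodule.mem_sup.1 (u c).2
      exact ⟨x, hx, y, hy, h⟩
    choose x hx y hy hu' using hxy
    have hu2 : LinearIndependent ℂ fun c => (u c : Fin n → ℂ) :=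
      hu.map' W.subtype W.ker_subtype
    let L : (Fin (r + 1) → ℂ) →ₗ[ℂ] (Fin n → ℂ) := Fintype.linearCombination ℂ fun c => (u c : Fin n → ℂ)
    -- A left inverse of the map given by the independent vectors is the right choice of `Φ`: its
    -- determinant is `1`.
    obtain ⟨φ, hφ⟩ := L.exists_leftInverse_of_injective
      (LinearMap.ker_eq_bot.2 hu2.fintypeLinearCombination_injective)
    let X : Matrix (Fin n) (Fin (r + 1)) ℂ := Matrix.of fun i c => x c i
    let Y : Matrix (Fin n) (Fin (r + 1)) ℂ := Matrix.of fun i c => y c i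
    have hXY : A * (G * X) + G * Y = LinearMap.toMatrix' L := by
      ext i c
      have h1 := congrFun (hcol X Y c) i
      rw [Matrix.col_apply] at h1
      rw [h1, LinearMap.toMatrix'_apply]
      have h2 : L (Pi.single c 1) = (u c : Fin n → ℂ) := by
        simp [L, Fintype.linearCombination_apply_single]
      rw [h2]
      exact congrFun (hu' c) i
    have h1 := hg (minorPolynomial A (LinearMap.toMatrix' φ) X Y)
      ⟨LinearMap.toMatrix' φ, X, Y, hx, hy, rfl⟩
    have h2 := (evalGL_minorPolynomial A (LinearMap.toMatrix' φ) X Y g).symm.trans h1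
    rw [← hG, hXY, ← LinearMap.toMatrix'_comp, hφ, LinearMap.toMatrix'_id, Matrix.det_one] at h2
    exact one_ne_zero h2

lemma isClosed_finrank_le (A : Matrix (Fin n) (Fin n) ℂ) (i j r : ℕ) :
    IsClosed {F : CompleteFlag n |
      finrank ℂ ↥((F.level i).map A.mulVecLin ⊔ F.level j) ≤ r} :=
  isClosed_flags_iff.2
    (exists_zeroSet_finrank_le A ((standardFlag n).level i) ((standardFlag n).level j) r)

end Determinantal

variable {p q : ℕ}

/-- As `E` and `E'` are the kernels of `1 - π` and `π`, lower bounds on intersections are upper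
bounds on the dimensions of images. Taking the zero space `F_0` as second summand makes all three
families instances of one closed condition. -/
lemma isClosed_rankLocus (γ : Clan p q) : IsClosed (rankLocus γ) := by
  have hzero : ∀ F : CompleteFlag (p + q), F.level 0 = ⊥ := fun F =>
    Submodule.finrank_eq_zero.1 (F.finrank_level (Nat.zero_le _))
  have hproj : (LinearMap.toMatrix' (proj p q)).mulVecLin = proj p q := by
    rw [← Matrix.toLin'_apply', Matrix.toLin'_toMatrix']
  have hproj' : (LinearMap.toMatrix' (LinearMap.id - proj p q)).mulVecLin =
      LinearMap.id - proj p q := by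
    rw [← Matrix.toLin'_apply', Matrix.toLin'_toMatrix']
  have hker : LinearMap.ker (LinearMap.id - proj p q) = E p q := by
    ext v
    rw [LinearMap.mem_ker, LinearMap.sub_apply, LinearMap.id_apply, sub_eq_zero, mem_E_iff, eq_comm]
  have hset : rankLocus γ =
      (⋂ i : Fin (p + q + 1), {F : CompleteFlag (p + q) | finrank ℂ
        ↥((F.level i).map (LinearMap.toMatrix' (LinearMap.id - proj p q)).mulVecLin ⊔ F.level 0) ≤
          i - γ.rankPlus i}) ∩
      ((⋂ i : Fin (p + q + 1), {F : CompleteFlag (p + q) | finrank ℂ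
        ↥((F.level i).map (LinearMap.toMatrix' (proj p q)).mulVecLin ⊔ F.level 0) ≤
          i - γ.rankMinus i}) ∩
      ⋂ i : Fin (p + q + 1), ⋂ j : Fin (p + q + 1), ⋂ _ : i < j,
        {F : CompleteFlag (p + q) | finrank ℂ
          ↥((F.level i).map (LinearMap.toMatrix' (proj p q)).mulVecLin ⊔ F.level j) ≤
            j + γ.rankCross i j}) := by
    ext F
    simp only [Set.mem_inter_iff, Set.mem_iInter, Set.mem_ofPred_eq]
    refine and_congr (forall_congr' fun i => ?_) (and_congr (forall_congr' fun i => ?_)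
      (forall_congr' fun i => forall_congr' fun j => ?_))
    rotate_right
    · rw [hproj, F.level_val, F.level_val]
    all_goals
      -- This bounds both rank numbers by `i`, so the truncated subtractions in the equations are
      -- genuine.
      have hi := γ.rankPlus_add_rankMinus_add_rankCross (i := i) (by omega)
      have hd := F.finrank_space i
      rw [hzero, sup_bot_eq, F.level_val]
      first | rw [hproj] | rw [hproj']
    · have h1 := finrank_map_add_finrank_inf_ker (LinearMap.id - proj p q) (F.space i)
      rw [hker] at h1
      omega
    · have h1 := finrank_map_add_finrank_inf_ker (proj p q) (F.space i)
      rw [← E'_eq_ker] at h1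
      omega
  rw [hset]
  refine (isClosed_iInter fun i => ?_).inter ((isClosed_iInter fun i => ?_).inter
    (isClosed_iInter fun i => isClosed_iInter fun j => isClosed_iInter fun _ => ?_)) <;>
  exact isClosed_finrank_le _ _ _ _

lemma Y_eq_rankLocus (γ : Clan p q) : Y γ = rankLocus γ :=
  Set.Subset.antisymm (closure_minimal (Q_subset_rankLocus γ) (isClosed_rankLocus γ))
    (rankLocus_subset_closure_Q γ)

/-! ### Flags with an adapted basis form exactly one `K`-orbit. -/

section Orbit

lemma mulVec_proj_of_mem_K {h : GL (Fin (p + q)) ℂ} (hh : h ∈ K p q) (v : Fin (p + q) → ℂ) :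
    (h : Matrix (Fin (p + q)) (Fin (p + q)) ℂ) *ᵥ proj p q v =
      proj p q ((h : Matrix (Fin (p + q)) (Fin (p + q)) ℂ) *ᵥ v) := by
  have hh' : ∀ k l : Fin (p + q), ¬ ((k : ℕ) < p ↔ (l : ℕ) < p) →
    (h : Matrix (Fin (p + q)) (Fin (p + q)) ℂ) k l = 0 := hh
  ext k
  rw [proj_apply]
  simp only [Matrix.mulVec, dotProduct, proj_apply]
  split_ifs with hk
  · refine Finset.sum_congr rfl fun l _ => ?_
    split_ifs with hl
    · rfl
    · rw [hh' k l (by tauto), zero_mul, zero_mul]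
  · refine Finset.sum_eq_zero fun l _ => ?_
    split_ifs with hl
    · rw [hh' k l (by tauto), zero_mul]
    · rw [mul_zero]

lemma smul_mem_adaptedFlags {γ : Clan p q} {F : CompleteFlag (p + q)} (hF : F ∈ adaptedFlags γ)
    {h : GL (Fin (p + q)) ℂ} (hh : h ∈ K p q) : h • F ∈ adaptedFlags γ := by
  obtain ⟨v, hv⟩ := hF
  have hinj : Function.Injective (h : Matrix (Fin (p + q)) (Fin (p + q)) ℂ).mulVecLin :=
    Matrix.mulVec_injective_of_isUnit h.isUnit
  refine ⟨fun k => (h : Matrix (Fin (p + q)) (Fin (p + q)) ℂ) *ᵥ v k, fun k => ?_, fun k => ?_,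
    fun k hk => ?_, fun k hk => ?_, fun k hk => ?_⟩
  · exact Submodule.mem_map_of_mem (f := (h : Matrix (Fin (p + q)) (Fin (p + q)) ℂ).mulVecLin)
      (hv.mem k)
  · rintro ⟨x, hx, hx'⟩
    exact hv.notMem k (hinj hx' ▸ hx)
  · rw [← mulVec_proj_of_mem_K hh, hv.plusOrClosing k hk]
  · rw [← mulVec_proj_of_mem_K hh, hv.minus k hk, Matrix.mulVec_zero]
  · rw [← mulVec_proj_of_mem_K hh, hv.opening k hk]

/-- Two flags with bases adapted to the same clan are conjugate under `K`. -/
lemma exists_mem_K_smul_eq {γ : Clan p q} {F F' : CompleteFlag (p + q)} (hF : F ∈ adaptedFlags γ)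
    (hF' : F' ∈ adaptedFlags γ) : ∃ h ∈ K p q, h • F = F' := by
  obtain ⟨v, hv⟩ := hF
  obtain ⟨w, hw⟩ := hF'
  have hvi := CompleteFlag.linearIndependent_of_mem_level hv.mem hv.notMem
  have hwi := CompleteFlag.linearIndependent_of_mem_level hw.mem hw.notMem
  obtain ⟨a, ha⟩ := exists_smul_standardFlag_of_linearIndependent hvi
  obtain ⟨b, hb⟩ := exists_smul_standardFlag_of_linearIndependent hwi
  have haF : a • standardFlag (p + q) = F := CompleteFlag.ext_level fun i hi => by
    rw [level_smul_standardFlag a hi, CompleteFlag.level_eq_span hv.mem hv.notMem hi]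
    simp only [ha]
  have hbF : b • standardFlag (p + q) = F' := CompleteFlag.ext_level fun i hi => by
    rw [level_smul_standardFlag b hi, CompleteFlag.level_eq_span hw.mem hw.notMem hi]
    simp only [hb]
  let H : (Fin (p + q) → ℂ) →ₗ[ℂ] (Fin (p + q) → ℂ) :=
    ((b * a⁻¹ : GL (Fin (p + q)) ℂ) : Matrix (Fin (p + q)) (Fin (p + q)) ℂ).mulVecLin
  have hH : ∀ k, H (v k) = w k := by
    intro k
    rw [← ha, ← hb, ← Matrix.mulVec_single_one, ← Matrix.mulVec_single_one]
    change ((b * a⁻¹ : GL (Fin (p + q)) ℂ) : Matrix (Fin (p + q)) (Fin (p + q)) ℂ) *ᵥ _ = _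
    rw [Matrix.mulVec_mulVec, ← Units.val_mul, inv_mul_cancel_right]
  -- The clan prescribes the same action of `π` on both bases, so commutation can be checked on
  -- basis vectors. Comparing matrix entries then makes the off-diagonal blocks vanish.
  have hcomm : H ∘ₗ proj p q = proj p q ∘ₗ H := by
    refine LinearMap.ext_on_range (hvi.span_eq_top_of_card_eq_finrank' (by simp)) fun k => ?_
    rw [LinearMap.comp_apply, LinearMap.comp_apply, hH]
    rcases lt_trichotomy (γ.inv k) k with h1 | h1 | h1
    · rw [hv.plusOrClosing k (Or.inr h1), hw.plusOrClosing k (Or.inr h1), hH]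
    · rcases (γ.fixed_iff k).1 h1 with h2 | h2
      · rw [hv.plusOrClosing k (Or.inl h2), hw.plusOrClosing k (Or.inl h2), hH]
      · rw [hv.minus k h2, hw.minus k h2, map_zero]
    · rw [hv.opening k h1, hw.opening k h1, hH]
  refine ⟨b * a⁻¹, fun k l hkl => ?_, by rw [← haF, ← hbF, mul_smul, inv_smul_smul]⟩
  have h1 := congrFun (LinearMap.congr_fun hcomm (Pi.single l 1)) k
  have h2 : H (Pi.single l 1) k =
      ((b * a⁻¹ : GL (Fin (p + q)) ℂ) : Matrix (Fin (p + q)) (Fin (p + q)) ℂ) k l := by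
    change (_ *ᵥ Pi.single l 1) k = _
    rw [Matrix.mulVec_single_one]
    rfl
  rw [LinearMap.comp_apply, LinearMap.comp_apply, proj_apply, h2] at h1
  by_cases hl : (l : ℕ) < p
  · have hk : ¬ (k : ℕ) < p := by tauto
    have h3 : proj p q (Pi.single l 1) = Pi.single l 1 :=
      mem_E_iff.1 (Submodule.subset_span ⟨l, hl, rfl⟩)
    rw [h3, h2, if_neg hk] at h1
    exact h1
  · have hk : (k : ℕ) < p := by tauto
    have h3 : proj p q (Pi.single l 1) = 0 :=
      mem_E'_iff.1 (Submodule.subset_span ⟨l, not_lt.1 hl, rfl⟩)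
    rw [h3, map_zero, if_pos hk] at h1
    exact h1.symm

/-- The signature condition enters here: the two rank numbers at the top add up to `p + q`, and
their difference is `p - q`. -/
lemma Clan.rankPlus_top (γ : Clan p q) : γ.rankPlus (p + q) = p := by
  have h1 := γ.rankPlus_add_rankMinus_add_rankCross le_rfl
  have h2 : γ.rankCross (p + q) (p + q) = 0 := by
    unfold Clan.rankCross
    rw [Finset.card_eq_zero, Finset.filter_eq_empty_iff]
    intro k _
    omega
  have h3 : γ.rankPlus (p + q) = γ.plus.card + γ.pairsUpTo (p + q) := by
    unfold Clan.rankPlus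
    rw [Finset.filter_true_of_mem fun k _ => k.2]
  have h4 : γ.rankMinus (p + q) = γ.minus.card + γ.pairsUpTo (p + q) := by
    unfold Clan.rankMinus
    rw [Finset.filter_true_of_mem fun k _ => k.2]
  have h5 := γ.signature
  omega

/-- Exactly `p` positions carry a `+` or close a pair. Standard basis vectors of `E` are assigned to
them and those of `E'` to the others, and to each opening vector the vector of its mate is added, so
that `π` returns the mate. -/
lemma adaptedFlags_nonempty (γ : Clan p q) : (adaptedFlags γ).Nonempty := by
  have hcard : Fintype.card {k // γ.PlusOrClosing k} =
      Fintype.card {k : Fin (p + q) // (k : ℕ) < p} := by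
    rw [Fintype.card_subtype, Fintype.card_subtype, Fin.card_filter_val_lt,
      min_eq_right (Nat.le_add_right p q)]
    conv_rhs => rw [← γ.rankPlus_top, γ.rankPlus_eq]
    congr 1
    ext k
    simp only [Finset.mem_filter, Finset.mem_univ, true_and]
    exact ⟨fun h => ⟨k.2, h⟩, fun h => h.2⟩
  let e : Equiv.Perm (Fin (p + q)) := (Fintype.equivOfCardEq hcard).extendSubtype
  let u : Fin (p + q) → Fin (p + q) → ℂ := fun k => Pi.single (e k) 1
  have hu1 : ∀ k, γ.PlusOrClosing k → proj p q (u k) = u k := fun k hk =>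
    mem_E_iff.1 (Submodule.subset_span ⟨e k, Equiv.extendSubtype_mem _ k hk, rfl⟩)
  have hu2 : ∀ k, ¬ γ.PlusOrClosing k → proj p q (u k) = 0 := fun k hk =>
    mem_E'_iff.1 (Submodule.subset_span ⟨e k, not_lt.1 (show ¬ (e k : ℕ) < p from
      Equiv.extendSubtype_not_mem (Fintype.equivOfCardEq hcard) k hk), rfl⟩)
  let v : Fin (p + q) → Fin (p + q) → ℂ := fun k => if k < γ.inv k then u k + u (γ.inv k) else u k
  have hv1 : ∀ k, k < γ.inv k → v k = u k + u (γ.inv k) := fun k hk => if_pos hk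
  have hv2 : ∀ k, ¬ k < γ.inv k → v k = u k := fun k hk => if_neg hk
  have hv3 : ∀ k, k < γ.inv k → v (γ.inv k) = u (γ.inv k) := fun k hk =>
    hv2 _ (by rw [γ.inv_inv]; exact hk.not_gt)
  have hspan : ∀ k, u k ∈ Submodule.span ℂ (Set.range v) := by
    intro k
    by_cases hk : k < γ.inv k
    · rw [show u k = v k - v (γ.inv k) by rw [hv1 k hk, hv3 k hk, add_sub_cancel_right]]
      exact Submodule.sub_mem _ (Submodule.subset_span ⟨k, rfl⟩) (Submodule.subset_span ⟨_, rfl⟩)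
    · rw [← hv2 k hk]
      exact Submodule.subset_span ⟨k, rfl⟩
  have hli : LinearIndependent ℂ v := by
    refine linearIndependent_of_top_le_span_of_card_eq_finrank ?_ (by simp)
    rw [← (Pi.basisFun ℂ (Fin (p + q))).span_eq, Submodule.span_le]
    rintro _ ⟨k, rfl⟩
    have := hspan (e.symm k)
    simpa [u] using this
  obtain ⟨g, hg⟩ := exists_smul_standardFlag_of_linearIndependent hli
  refine ⟨g • standardFlag (p + q), v, fun k => ?_, fun k => ?_, fun k hk => ?_, fun k hk => ?_,
    fun k hk => ?_⟩
  · rw [level_smul_standardFlag g (by omega)]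
    exact Submodule.subset_span ⟨k, Nat.lt_succ_self k, hg k⟩
  · rw [level_smul_standardFlag g (by omega)]
    simp only [hg]
    exact hli.notMem_span_image (lt_irrefl (k : ℕ))
  · have h1 : ¬ k < γ.inv k := by
      rcases hk with hk | hk
      · rw [γ.inv_eq_of_mem_plus hk]; exact lt_irrefl k
      · exact hk.not_gt
    rw [hv2 k h1, hu1 k hk]
  · have h1 := γ.inv_eq_of_mem_minus hk
    rw [hv2 k (by rw [h1]; exact lt_irrefl k), hu2 k]
    rintro (h2 | h2)
    · exact γ.notMem_minus_of_mem_plus h2 hk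
    · rw [h1] at h2; exact lt_irrefl k h2
  · rw [hv3 k hk, hv1 k hk, map_add, hu2 k, hu1 _ (Or.inr (by rwa [γ.inv_inv])), zero_add]
    rintro (h2 | h2)
    · rw [γ.inv_eq_of_mem_plus h2] at hk; exact lt_irrefl k hk
    · exact lt_asymm h2 hk

lemma exists_Q_eq_orbit (γ : Clan p q) :
    ∃ F₀ : CompleteFlag (p + q), Q γ = MulAction.orbit (K p q) F₀ := by
  obtain ⟨F₀, hF₀⟩ := adaptedFlags_nonempty γ
  refine ⟨F₀, ?_⟩
  rw [Q_eq_adaptedFlags]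
  ext F
  constructor
  · intro hF
    obtain ⟨h, hh, rfl⟩ := exists_mem_K_smul_eq hF₀ hF
    exact ⟨⟨h, hh⟩, rfl⟩
  · rintro ⟨⟨h, hh⟩, rfl⟩
    exact smul_mem_adaptedFlags hF₀ hh

end Orbit

end

end ClanOrbits

/-- `Q_γ` is a single `K`-orbit on the flag variety, and its closure `Y_γ` is cut out by the
inequalities. -/
theorem corollary1p3 (p q : ℕ) (γ : ClanOrbits.Clan p q) :
    (∃ F₀ : ClanOrbits.CompleteFlag (p + q),
      ClanOrbits.Q γ = MulAction.orbit (ClanOrbits.K p q) F₀) ∧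
    ClanOrbits.Y γ =
      {F : ClanOrbits.CompleteFlag (p + q) |
        (∀ i : Fin (p + q + 1),
          γ.rankPlus i ≤ Module.finrank ℂ ↥(F.space i ⊓ ClanOrbits.E p q)) ∧
        (∀ i : Fin (p + q + 1),
          γ.rankMinus i ≤ Module.finrank ℂ ↥(F.space i ⊓ ClanOrbits.E' p q)) ∧
        ∀ i j : Fin (p + q + 1), i < j →
          Module.finrank ℂ ↥((F.space i).map (ClanOrbits.proj p q) ⊔ F.space j) ≤
            (j : ℕ) + γ.rankCross i j} :=
  ⟨ClanOrbits.exists_Q_eq_orbit γ, ClanOrbits.Y_eq_rankLocus γ⟩
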